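/- Let $\mathbb{A}=(\mathcal{A},\leq,\to,\Sigma)$ be an implicative algebra: a complete lattice with an operation $\to$, antitone in the first and monotone in the second variable, such that $a\to\bigwedge B=\bigwedge_{b\in B}(a\to b)$ for all $B\subseteq\mathcal A$, and an upward closed $\Sigma\subseteq\mathcal{A}$, closed under modus ponens, containing $\bigwedge_{a,b}(a\to b\to a)$ and $\bigwedge_{a,b,c}((a\to b\to c)\to(a\to b)\to a\to c)$. Put $a\times b:=\bigwedge_{x}((a\to b\to x)\to x)$ and $\exists_{i\in I}c_i:=\bigwedge_{x}\big(\bigwedge_{i\in I}(c_i\to x)\to x\big)$. A family $(a_i)_{i\in I}$ in $\mathcal{A}$ is SK if for all families $((b^i_j)_{j\in J_i})_{i\in I}$ with $\bigwedge_i(a_i\to\exists_{j\in J_i}b^i_j)\in\Sigma$ there is $f\in\prod_iJ_i$ with $\bigwedge_i(a_i\to b^i_{f(i)})\in\Sigma$; it is U-SK if $(a_{f(k)})_{k\in K}$ is SK for every function $f:K\to I$. The algebra $\mathbb{A}$ is *uniformly supercoherent* if (i) whenever $\bigwedge_{k\in K}\exists_{j\in J_k}b^k_j\in\Sigma$, there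 is $f\in\prod_kJ_k$ with $\bigwedge_kb^k_{f(k)}\in\Sigma$; (ii) if $(a_i)_{i\in I}$ and $(b_i)_{i\in I}$ are U-SK, so is $(a_i\times b_i)_{i\in I}$; (iii) for every family $(a_j)_{j\in J}$ there are a function $f:I\to J$ and a U-SK family $(b_i)_{i\in I}$ such that $\bigwedge_j(a_j\to\exists_{f(i)=j}b_i)\in\Sigma$ and $\bigwedge_j((\exists_{f(i)=j}b_i)\to a_j)\in\Sigma$. Let $\mathsf{P}$ be the implicative tripos of $\mathbb{A}$: $\mathsf{P}(I)$ is the poset reflection of $\mathcal{A}^I$ preordered by $\varphi\vdash\psi$ iff $\bigwedge_i(\varphi(i)\to\psi(i))\in\Sigma$, $\mathsf{P}_f$ is precomposition with $f$, $\exists_f\dashv\mathsf{P}_f$, and $\delta_B=\exists_{\Delta_B}\top$. A predicate $\varphi\in\mathsf{P}(I)$ is SK$_p$ if, whenever $\varphi\leq\exists_f(\psi)$ with $f:J\to I$ and $\psi\in\mathsf P(J)$, there is $g:I\to J$ with $fg=\mathrm{id}_I$ and $\varphi\leq\mathsf{P}_g(\psi)$; it is U-SK$_p$ if $\mathsf{P}_f(\varphi)$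 is SK$_p$ for every function $f$ into $I$. The Grothendieck category $\Gamma[\mathsf{P}]$ has as objects the pairs $(A,\alpha)$ with $A$ a set and $\alpha\in\mathsf{P}(A)$, and as arrows $(A,\alpha)\to(B,\beta)$ the functions $f:A\to B$ with $\alpha\leq\mathsf{P}_f(\beta)$. The category of partitioned assemblies $\mathbf{PAsm}_{\mathsf{P}}$ is its full subcategory on the $(A,\alpha)$ with $\alpha$ U-SK$_p$. The regular completion $\mathbf{Reg}_{\mathsf{P}}$ has the same objects as $\Gamma[\mathsf{P}]$; its arrows $(A,\alpha)\to(B,\beta)$ are the $\phi\in\mathsf{P}(A\times B)$ with $\phi\leq\mathsf{P}_{\pi_1}\alpha\wedge\mathsf{P}_{\pi_2}\beta$, $\alpha\leq\exists_{\pi_1}\phi$ and $\mathsf{P}_{\langle\pi_1,\pi_2\rangle}\phi\wedge\mathsf{P}_{\langle\pi_1,\pi_3\rangle}\phi\leq\mathsf{P}_{\langle\pi_2,\pi_3\rangle}\delta_B$, with relational composition. Let $\mathbf{F}:\Gamma[\mathsf{P}]\to\mathbf{Reg}_{\mathsf{P}}$ be the functor that is the identity on objects and sends $f:(A,\alpha)\to(B,\beta)$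 to $\exists_{\langle\mathrm{id}_A,f\rangle}(\alpha)$; partitioned assemblies are regarded in $\mathbf{Reg}_{\mathsf{P}}$ through the restriction of $\mathbf{F}$. **Theorem.** $\mathbb{A}$ is uniformly supercoherent if and only if both of the following hold: 1. $\mathbf{PAsm}_{\mathsf{P}}$ is a lex full subcategory of $\mathbf{Reg}_{\mathsf{P}}$, in the sense that $\mathbf{PAsm}_{\mathsf{P}}$ has finite limits, which are those of $\Gamma[\mathsf{P}]$ (the inclusion $\mathbf{PAsm}_{\mathsf{P}}\hookrightarrow\Gamma[\mathsf{P}]$ preserves them), and the functor $\mathbf{PAsm}_{\mathsf{P}}\hookrightarrow\Gamma[\mathsf{P}]\xrightarrow{\mathbf{F}}\mathbf{Reg}_{\mathsf{P}}$ is full, faithful and preserves finite limits; 2. $\mathbf{PAsm}_{\mathsf{P}}$ is a projective cover of $\mathbf{Reg}_{\mathsf{P}}$: each partitioned assembly is projective in $\mathbf{Reg}_{\mathsf{P}}$ with respect to regular epimorphisms, and each object of $\mathbf{Reg}_{\mathsf{P}}$ is the codomain of a regular epimorphism whose domain is a partitioned assembly. -/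

import Mathlib

open CategoryTheory CategoryTheory.Limits

universe u v w

/-! ## Implicative algebras -/

/-- An implicative structure: a complete lattice with an implication that is antitone in the
first variable, monotone in the second one, and commutes with arbitrary meets on the right. -/
class ImplicativeStructure (A : Type u) extends CompleteLattice A where
  imp : A → A → A
  imp_mono : ∀ {a a' b b' : A}, a' ≤ a → b ≤ b' → imp a b ≤ imp a' b'
  imp_sInf : ∀ (a : A) (B : Set A), imp a (sInf B) = ⨅ b ∈ B, imp a b

infixr:60 " ⇝ " => ImplicativeStructure.imp

/-- An implicative algebra: an implicative structure with a separator `sep`. -/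
class ImplicativeAlgebra (A : Type u) extends ImplicativeStructure A where
  sep : Set A
  sep_up : ∀ {a b : A}, a ∈ sep → a ≤ b → b ∈ sep
  k_mem : (⨅ (a : A) (b : A), a ⇝ b ⇝ a) ∈ sep
  s_mem : (⨅ (a : A) (b : A) (c : A), (a ⇝ b ⇝ c) ⇝ (a ⇝ b) ⇝ a ⇝ c) ∈ sep
  sep_mp : ∀ {a b : A}, (a ⇝ b) ∈ sep → a ∈ sep → b ∈ sep

namespace ImplicativeAlgebra

section Connectives

variable {A : Type u} [ImplicativeAlgebra A]

/-- Logical entailment `a ⊢ b`. -/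
def Ent (a b : A) : Prop := (a ⇝ b) ∈ (sep : Set A)

/-- Logical conjunction `a × b`. -/
def conj (a b : A) : A := ⨅ x : A, (a ⇝ b ⇝ x) ⇝ x

/-- Logical disjunction `a + b`. -/
def disj (a b : A) : A := ⨅ x : A, (a ⇝ x) ⇝ (b ⇝ x) ⇝ x

/-- Existential quantification of a family. -/
def bigExists {I : Type v} (c : I → A) : A := ⨅ x : A, (⨅ i, c i ⇝ x) ⇝ x

theorem imp_iInf (a : A) {I : Sort v} (f : I → A) : (a ⇝ ⨅ i, f i) = ⨅ i, a ⇝ f i := by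
  rw [iInf, ImplicativeStructure.imp_sInf, iInf_range]

/-- The power `I → A` with pointwise operations and the uniform power separator
`{f | ⨅ i, f i ∈ sep}`. -/
instance power (I : Type v) : ImplicativeAlgebra (I → A) where
  toCompleteLattice := inferInstance
  imp f g := fun i => f i ⇝ g i
  imp_mono h h' := fun i => ImplicativeStructure.imp_mono (h i) (h' i)
  imp_sInf f B := by
    funext i
    simp only [sInf_apply, iInf_apply, imp_iInf]
    rw [iInf_subtype]
  sep := {f | (⨅ i, f i) ∈ (sep : Set A)}
  sep_up h h' := sep_up h (iInf_mono h')
  k_mem := by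
    refine sep_up k_mem (le_iInf fun i => ?_)
    simp only [iInf_apply]
    exact le_iInf fun f => le_iInf fun g => (iInf_le _ (f i)).trans (iInf_le _ (g i))
  s_mem := by
    refine sep_up s_mem (le_iInf fun i => ?_)
    simp only [iInf_apply]
    exact le_iInf fun f => le_iInf fun g => le_iInf fun h =>
      (iInf_le _ (f i)).trans ((iInf_le _ (g i)).trans (iInf_le _ (h i)))
  sep_mp {f g} h h' := by
    have key : ((⨅ i, f i) ⇝ ⨅ i, g i) ∈ (sep : Set A) := by
      rw [imp_iInf]
      exact sep_up h (iInf_mono fun i => ImplicativeStructure.imp_mono (iInf_le _ i) le_rfl)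
    exact sep_mp key h'

theorem mem_power {I : Type v} {f : I → A} :
    f ∈ (sep : Set (I → A)) ↔ (⨅ i, f i) ∈ (sep : Set A) := Iff.rfl

theorem ent_power {I : Type v} {f g : I → A} :
    Ent f g ↔ (⨅ i, f i ⇝ g i) ∈ (sep : Set A) := Iff.rfl

/-! ### Basic facts about entailment -/

variable {a b c x : A}

theorem k_sep (a b : A) : (a ⇝ b ⇝ a) ∈ (sep : Set A) :=
  sep_up k_mem ((iInf_le _ a).trans (iInf_le _ b))

theorem s_sep (a b c : A) : ((a ⇝ b ⇝ c) ⇝ (a ⇝ b) ⇝ a ⇝ c) ∈ (sep : Set A) :=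
  sep_up s_mem ((iInf_le _ a).trans ((iInf_le _ b).trans (iInf_le _ c)))

theorem ent_of_mem (c : A) (h : a ∈ (sep : Set A)) : Ent c a := sep_mp (k_sep a c) h

theorem ent_mp (h : Ent c (a ⇝ b)) (h' : Ent c a) : Ent c b :=
  sep_mp (sep_mp (s_sep c a b) h) h'

theorem ent_refl (a : A) : Ent a a := ent_mp (k_sep a (a ⇝ a)) (k_sep a a)

theorem Ent.trans (h : Ent a b) (h' : Ent b c) : Ent a c := ent_mp (ent_of_mem a h') h

theorem ent_of_le (h : a ≤ b) : Ent a b :=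
  sep_up (ent_refl a) (ImplicativeStructure.imp_mono le_rfl h)

theorem ent_flip (h : Ent a (b ⇝ c)) : Ent b (a ⇝ c) :=
  Ent.trans (k_sep b a) (sep_mp (s_sep a b c) h)

theorem ent_pair_aux (h : Ent c a) (h' : Ent c b) : Ent c ((a ⇝ b ⇝ x) ⇝ x) := by
  apply ent_flip
  have h1 : Ent (a ⇝ b ⇝ x) (c ⇝ b ⇝ x) := ent_flip (h.trans (ent_flip (ent_refl _)))
  exact ent_mp (h1.trans (s_sep c b x)) (ent_of_mem _ h')

/-! ### Entailment between families -/

variable {I : Type v} {J : Type w} {φ ψ χ : I → A}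

theorem ent_comp (h : Ent φ ψ) (f : J → I) : Ent (φ ∘ f) (ψ ∘ f) :=
  ent_power.2 (sep_up h (le_iInf fun j => iInf_le (fun i => φ i ⇝ ψ i) (f j)))

theorem ent_iInf {X : Type w} {F : I → X → A} :
    Ent φ (fun i => ⨅ x, F i x) ↔
      Ent (fun p : I × X => φ p.1) (fun p : I × X => F p.1 p.2) := by
  simp only [ent_power, imp_iInf, iInf_prod]

theorem ent_conj (h : Ent φ ψ) (h' : Ent φ χ) : Ent φ (fun i => conj (ψ i) (χ i)) := by
  unfold conj
  rw [ent_iInf]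
  exact ent_pair_aux (x := fun p : I × A => p.2) (ent_comp h Prod.fst) (ent_comp h' Prod.fst)

theorem conj_ent_left : Ent (fun i => conj (φ i) (ψ i)) φ :=
  ent_mp (ent_of_le (b := (φ ⇝ ψ ⇝ φ) ⇝ φ) fun i => iInf_le _ (φ i)) (ent_of_mem _ (k_sep φ ψ))

theorem conj_ent_right : Ent (fun i => conj (φ i) (ψ i)) ψ :=
  ent_mp (ent_of_le (b := (φ ⇝ ψ ⇝ ψ) ⇝ ψ) fun i => iInf_le _ (ψ i))
    (ent_of_mem _ (ent_of_mem φ (ent_refl ψ)))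

theorem ent_imp_iff : Ent φ (ψ ⇝ χ) ↔ Ent (fun i => conj (φ i) (ψ i)) χ := by
  constructor
  · intro h
    exact ent_mp (conj_ent_left.trans h) conj_ent_right
  · intro h
    have h1 : Ent φ (ψ ⇝ fun i => conj (φ i) (ψ i)) := by
      have e : (ψ ⇝ fun i => conj (φ i) (ψ i)) =
          fun i => ⨅ x : A, ψ i ⇝ (φ i ⇝ ψ i ⇝ x) ⇝ x := by
        funext i
        exact imp_iInf _ _
      rw [e, ent_iInf]
      set φ' : I × A → A := fun p => φ p.1
      set ψ' : I × A → A := fun p => ψ p.1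
      set x' : I × A → A := fun p => p.2
      change Ent φ' (ψ' ⇝ (φ' ⇝ ψ' ⇝ x') ⇝ x')
      have h2 : Ent φ' ((φ' ⇝ ψ' ⇝ x') ⇝ ψ' ⇝ x') := ent_flip (ent_refl _)
      have h3 : Ent ((φ' ⇝ ψ' ⇝ x') ⇝ ψ' ⇝ x') (ψ' ⇝ (φ' ⇝ ψ' ⇝ x') ⇝ x') := by
        apply ent_flip
        have := s_sep (φ' ⇝ ψ' ⇝ x') ψ' x'
        exact Ent.trans (k_sep ψ' (φ' ⇝ ψ' ⇝ x')) (ent_flip this)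
      exact h2.trans h3
    have h2 : Ent (ψ ⇝ fun i => conj (φ i) (ψ i)) (ψ ⇝ χ) :=
      sep_mp (s_sep _ _ _) (ent_of_mem _ h)
    exact h1.trans h2

theorem ent_disj_left : Ent φ (fun i => disj (φ i) (ψ i)) := by
  unfold disj
  rw [ent_iInf]
  set φ' : I × A → A := fun p => φ p.1
  set ψ' : I × A → A := fun p => ψ p.1
  set x' : I × A → A := fun p => p.2
  change Ent φ' ((φ' ⇝ x') ⇝ (ψ' ⇝ x') ⇝ x')
  exact ent_flip (Ent.trans (b := φ' ⇝ x') (ent_refl _)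
    (sep_mp (s_sep _ _ _) (ent_of_mem _ (k_sep x' (ψ' ⇝ x')))))

theorem ent_disj_right : Ent ψ (fun i => disj (φ i) (ψ i)) := by
  unfold disj
  rw [ent_iInf]
  set φ' : I × A → A := fun p => φ p.1
  set ψ' : I × A → A := fun p => ψ p.1
  set x' : I × A → A := fun p => p.2
  change Ent ψ' ((φ' ⇝ x') ⇝ (ψ' ⇝ x') ⇝ x')
  exact (ent_flip (ent_refl _)).trans (k_sep _ _)

theorem disj_ent (h : Ent φ χ) (h' : Ent ψ χ) : Ent (fun i => disj (φ i) (ψ i)) χ :=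
  ent_mp (ent_mp (ent_of_le (b := (φ ⇝ χ) ⇝ (ψ ⇝ χ) ⇝ χ) fun i => iInf_le _ (χ i))
    (ent_of_mem _ h)) (ent_of_mem _ h')

theorem exists_ent_iff {f : J → I} {θ : J → A} :
    Ent (fun i => bigExists fun j : {j // f j = i} => θ j.1) φ ↔ Ent θ (φ ∘ f) := by
  constructor
  · intro h
    refine Ent.trans ?_ (ent_comp h f)
    change Ent θ (fun k => ⨅ x : A, (⨅ j : {j // f j = f k}, θ j.1 ⇝ x) ⇝ x)
    rw [ent_iInf]
    apply ent_flip
    exact ent_of_le fun p => iInf_le (fun j : {j // f j = f p.1} => θ j.1 ⇝ p.2) ⟨p.1, rfl⟩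
  · intro h
    refine ent_mp (a := fun i => ⨅ j : {j // f j = i}, θ j.1 ⇝ φ i)
      (ent_of_le fun i => iInf_le _ (φ i)) (ent_of_mem _ ?_)
    refine mem_power.2 (sep_up h (le_iInf fun i => le_iInf ?_))
    rintro ⟨j, rfl⟩
    exact iInf_le (fun j => θ j ⇝ φ (f j)) j

end Connectives

/-! ## Supercompact families and uniformly supercoherent algebras -/

section Supercompact

variable {A : Type u} [ImplicativeAlgebra A]

/-- Supercompact (SK) families. -/
def SK {I : Type u} (a : I → A) : Prop :=
  ∀ (J : I → Type u) (b : ∀ i, J i → A),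
    (⨅ i, a i ⇝ bigExists (b i)) ∈ (sep : Set A) →
      ∃ f : ∀ i, J i, (⨅ i, a i ⇝ b i (f i)) ∈ (sep : Set A)

/-- Uniformly supercompact (U-SK) families. -/
def USK {I : Type u} (a : I → A) : Prop :=
  ∀ (K : Type u) (f : K → I), SK (fun k => a (f k))

variable (A)

def ChoiceRule : Prop :=
  ∀ (K : Type u) (J : K → Type u) (b : ∀ k, J k → A),
    (⨅ k, bigExists (b k)) ∈ (sep : Set A) →
      ∃ f : ∀ k, J k, (⨅ k, b k (f k)) ∈ (sep : Set A)

structure UniformlySupercoherent : Prop where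
  choice : ChoiceRule A
  conj : ∀ (I : Type u) (a b : I → A), USK a → USK b → USK (fun i => conj (a i) (b i))
  cover : ∀ (J : Type u) (a : J → A), ∃ (I : Type u) (f : I → J) (b : I → A), USK b ∧
    (⨅ j, a j ⇝ bigExists fun i : {i // f i = j} => b i.1) ∈ (sep : Set A) ∧
    (⨅ j, (bigExists fun i : {i // f i = j} => b i.1) ⇝ a j) ∈ (sep : Set A)

end Supercompact

/-! ## The implicative tripos -/

section Tripos

variable (A : Type u) [ImplicativeAlgebra A]

/-- Logical equivalence of predicates over `I`. -/
def predSetoid (I : Type u) : Setoid (I → A) where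
  r φ ψ := Ent φ ψ ∧ Ent ψ φ
  iseqv := ⟨fun φ => ⟨ent_refl φ, ent_refl φ⟩, fun h => ⟨h.2, h.1⟩,
    fun h h' => ⟨h.1.trans h'.1, h'.2.trans h.2⟩⟩

/-- The fibre `P(I)` of the implicative tripos: the posetal reflection of the preorder of
`A`-valued predicates over `I` under uniform entailment. -/
def Pred (I : Type u) : Type u := Quotient (predSetoid A I)

variable {A}

namespace Pred

variable {I J K : Type u}

/-- The class of a predicate. -/
def mk (φ : I → A) : Pred A I := Quotient.mk (predSetoid A I) φ

instance : PartialOrder (Pred A I) where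
  le := Quotient.lift₂ (fun φ ψ => Ent φ ψ) fun _ _ _ _ h h' =>
    propext ⟨fun e => h.2.trans (e.trans h'.1), fun e => h.1.trans (e.trans h'.2)⟩
  le_refl := by rintro ⟨φ⟩; exact ent_refl φ
  le_trans := by rintro ⟨φ⟩ ⟨ψ⟩ ⟨χ⟩ h h'; exact Ent.trans h h'
  le_antisymm := by rintro ⟨φ⟩ ⟨ψ⟩ h h'; exact Quotient.sound ⟨h, h'⟩

theorem mk_le_mk {φ ψ : I → A} : mk φ ≤ mk ψ ↔ Ent φ ψ := Iff.rfl

/-- The fibres are Heyting algebras; all connectives act pointwise on representatives. -/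
instance : HeytingAlgebra (Pred A I) where
  inf := Quotient.map₂ (fun φ ψ i => conj (φ i) (ψ i)) fun _ _ h _ _ h' =>
    ⟨ent_conj (conj_ent_left.trans h.1) (conj_ent_right.trans h'.1),
      ent_conj (conj_ent_left.trans h.2) (conj_ent_right.trans h'.2)⟩
  inf_le_left := by rintro ⟨φ⟩ ⟨ψ⟩; exact conj_ent_left
  inf_le_right := by rintro ⟨φ⟩ ⟨ψ⟩; exact conj_ent_right
  le_inf := by rintro ⟨φ⟩ ⟨ψ⟩ ⟨χ⟩ h h'; exact ent_conj h h'
  sup := Quotient.map₂ (fun φ ψ i => disj (φ i) (ψ i)) fun _ _ h _ _ h' =>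
    ⟨disj_ent (h.1.trans ent_disj_left) (h'.1.trans ent_disj_right),
      disj_ent (h.2.trans ent_disj_left) (h'.2.trans ent_disj_right)⟩
  le_sup_left := by rintro ⟨φ⟩ ⟨ψ⟩; exact ent_disj_left
  le_sup_right := by rintro ⟨φ⟩ ⟨ψ⟩; exact ent_disj_right
  sup_le := by rintro ⟨φ⟩ ⟨ψ⟩ ⟨χ⟩ h h'; exact disj_ent h h'
  top := mk fun _ => ⊤
  le_top := by rintro ⟨φ⟩; exact ent_of_le (b := fun _ => ⊤) fun _ => le_top
  bot := mk fun _ => ⊥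
  bot_le := by rintro ⟨φ⟩; exact ent_of_le (a := fun _ => ⊥) fun _ => bot_le
  himp := Quotient.map₂ (fun φ ψ i => φ i ⇝ ψ i) fun φ φ' h ψ ψ' h' =>
    ⟨ent_imp_iff.2 ((ent_mp conj_ent_left (conj_ent_right.trans h.2)).trans h'.1),
      ent_imp_iff.2 ((ent_mp conj_ent_left (conj_ent_right.trans h.1)).trans h'.2)⟩
  le_himp_iff := by rintro ⟨φ⟩ ⟨ψ⟩ ⟨χ⟩; exact ent_imp_iff
  compl := Quotient.map (fun φ i => φ i ⇝ ⊥) fun φ φ' h =>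
    ⟨ent_imp_iff.2 (ent_mp conj_ent_left (conj_ent_right.trans h.2)),
      ent_imp_iff.2 (ent_mp conj_ent_left (conj_ent_right.trans h.1))⟩
  himp_bot := by rintro ⟨φ⟩; rfl

/-- Reindexing `P_f`. -/
def reindex (f : J → I) : Pred A I → Pred A J :=
  Quotient.map (fun φ => φ ∘ f) fun _ _ h => ⟨ent_comp h.1 f, ent_comp h.2 f⟩

/-- The left adjoint `∃_f` of reindexing. -/
def ex (f : J → I) : Pred A J → Pred A I :=
  Quotient.map (fun θ i => bigExists fun j : {j // f j = i} => θ j.1) fun _ _ h =>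
    ⟨exists_ent_iff.2 (h.1.trans (exists_ent_iff.1 (ent_refl _))),
      exists_ent_iff.2 (h.2.trans (exists_ent_iff.1 (ent_refl _)))⟩

theorem ex_le_iff {f : J → I} {p : Pred A J} {q : Pred A I} : ex f p ≤ q ↔ p ≤ reindex f q := by
  induction p using Quotient.inductionOn
  induction q using Quotient.inductionOn
  exact exists_ent_iff

theorem reindex_mono (f : J → I) {p q : Pred A I} (h : p ≤ q) : reindex f p ≤ reindex f q := by
  induction p using Quotient.inductionOn
  induction q using Quotient.inductionOn
  exact ent_comp h f

@[simp] theorem reindex_inf (f : J → I) (p q : Pred A I) :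
    reindex f (p ⊓ q) = reindex f p ⊓ reindex f q := by
  induction p using Quotient.inductionOn
  induction q using Quotient.inductionOn
  rfl

@[simp] theorem reindex_top (f : J → I) : reindex f (⊤ : Pred A I) = ⊤ := rfl

@[simp] theorem reindex_reindex (f : J → I) (g : K → J) (p : Pred A I) :
    reindex g (reindex f p) = reindex (fun k => f (g k)) p := by
  induction p using Quotient.inductionOn
  rfl

@[simp] theorem reindex_id (p : Pred A I) : reindex (fun i => i) p = p := by
  induction p using Quotient.inductionOn
  rfl

/-- Introduction rule: a function `k` picking witnesses proves an existential statement. -/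
theorem le_reindex_ex {f : J → I} {h : K → I} (k : K → J) (hk : ∀ x, f (k x) = h x)
    {p : Pred A J} {q : Pred A K} (hq : q ≤ reindex k p) : q ≤ reindex h (ex f p) := by
  obtain rfl : (fun x => f (k x)) = h := funext hk
  have := reindex_mono k (ex_le_iff.1 (le_refl (ex f p)))
  rw [reindex_reindex] at this
  exact hq.trans this

/-- The Beck-Chevalley condition, for the canonical pullback. -/
theorem reindex_ex (f : J → I) (h : K → I) (p : Pred A J) :
    reindex h (ex f p) =
      ex (fun w : {w : K × J // f w.2 = h w.1} => w.1.1) (reindex (fun w => w.1.2) p) := by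
  induction p using Quotient.inductionOn with
  | h θ =>
    refine congrArg (Quotient.mk (predSetoid A K)) (funext fun k => ?_)
    refine iInf_congr fun x => congrArg (fun z => z ⇝ x) ?_
    apply le_antisymm
    · refine le_iInf ?_
      rintro ⟨⟨⟨k', j⟩, hw⟩, rfl⟩
      exact iInf_le (fun j : {j // f j = h k'} => θ j.1 ⇝ x) ⟨j, hw⟩
    · refine le_iInf ?_
      rintro ⟨j, hj⟩
      exact iInf_le (fun w : {w : {w : K × J // f w.2 = h w.1} // w.1.1 = k} =>
        θ w.1.1.2 ⇝ x) ⟨⟨(k, j), hj⟩, rfl⟩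

/-- Elimination rule for an existential hypothesis, with a side hypothesis `q`. -/
theorem inf_reindex_ex_le {f : J → I} {h : K → I} {p : Pred A J} {q r : Pred A K}
    (H : reindex (fun w : {w : K × J // f w.2 = h w.1} => w.1.1) q ⊓
        reindex (fun w => w.1.2) p ≤ reindex (fun w => w.1.1) r) :
    q ⊓ reindex h (ex f p) ≤ r := by
  rw [reindex_ex, inf_comm, ← le_himp_iff, ex_le_iff]
  have e : reindex (fun w : {w : K × J // f w.2 = h w.1} => w.1.1) (q ⇨ r) =
      reindex (fun w => w.1.1) q ⇨ reindex (fun w => w.1.1) r := by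
    clear H
    induction q using Quotient.inductionOn
    induction r using Quotient.inductionOn
    rfl
  rw [e, le_himp_iff, inf_comm]
  exact H

theorem reindex_ex_le {f : J → I} {h : K → I} {p : Pred A J} {r : Pred A K}
    (H : reindex (fun w : {w : K × J // f w.2 = h w.1} => w.1.2) p ≤
      reindex (fun w => w.1.1) r) :
    reindex h (ex f p) ≤ r := by
  refine le_trans (le_inf le_top le_rfl) (inf_reindex_ex_le (q := ⊤) ?_)
  exact inf_le_right.trans H

/-- The equality predicate `δ_I = ∃_Δ ⊤`. -/
def eqPred (A : Type u) [ImplicativeAlgebra A] (I : Type u) : Pred A (I × I) :=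
  ex (fun i => (i, i)) ⊤

/-- Supercompact predicates. -/
def IsSK (p : Pred A I) : Prop :=
  ∀ (J : Type u) (f : J → I) (q : Pred A J), p ≤ ex f q →
    ∃ g : I → J, p ≤ reindex g q ∧ ∀ i, f (g i) = i

/-- Uniformly supercompact predicates. -/
def IsUSK (p : Pred A I) : Prop :=
  ∀ (J : Type u) (f : J → I), (reindex f p).IsSK

end Pred

end Tripos

/-! ## The Grothendieck category, partitioned assemblies and the regular completion -/

section Categories

open ImplicativeAlgebra.Pred

/-- Objects of the Grothendieck category of the tripos. -/
structure Groth (A : Type u) [ImplicativeAlgebra A] : Type (u + 1) where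
  set : Type u
  pred : Pred A set

/-- Objects of the regular completion of the tripos. -/
structure Reg (A : Type u) [ImplicativeAlgebra A] : Type (u + 1) where
  set : Type u
  pred : Pred A set

variable {A : Type u} [ImplicativeAlgebra A]

namespace Groth

/-- Morphisms of the Grothendieck category: functions `f` with `α ≤ P_f β`. -/
@[ext] structure Hom (X Y : Groth A) : Type u where
  fn : X.set → Y.set
  le : X.pred ≤ reindex fn Y.pred

instance : Category.{u} (Groth A) where
  Hom := Hom
  id X := ⟨fun x => x, by simp⟩
  comp f g := ⟨fun x => g.fn (f.fn x), by
    have := reindex_mono f.fn g.le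
    rw [reindex_reindex] at this
    exact f.le.trans this⟩

end Groth

namespace Reg

/-- Morphisms of the regular completion: total functional relations. -/
@[ext] structure Hom (X Y : Reg A) : Type u where
  rel : Pred A (X.set × Y.set)
  le : rel ≤ reindex (fun p => p.1) X.pred ⊓ reindex (fun p => p.2) Y.pred
  total : X.pred ≤ ex (fun p => p.1) rel
  functional : reindex (fun p : X.set × Y.set × Y.set => (p.1, p.2.1)) rel ⊓
    reindex (fun p => (p.1, p.2.2)) rel ≤ reindex (fun p => (p.2.1, p.2.2)) (eqPred A Y.set)

/-- Relational composition. -/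
def compRel {X Y Z : Type u} (φ : Pred A (X × Y)) (ψ : Pred A (Y × Z)) : Pred A (X × Z) :=
  ex (fun p : X × Y × Z => (p.1, p.2.2))
    (reindex (fun p => (p.1, p.2.1)) φ ⊓ reindex (fun p => (p.2.1, p.2.2)) ψ)

theorem comp_le {X Y Z : Type u} {α : Pred A X} {β : Pred A Y} {γ : Pred A Z}
    {φ : Pred A (X × Y)} {ψ : Pred A (Y × Z)}
    (hφ : φ ≤ reindex (fun p => p.1) α ⊓ reindex (fun p => p.2) β)
    (hψ : ψ ≤ reindex (fun p => p.1) β ⊓ reindex (fun p => p.2) γ) :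
    compRel φ ψ ≤ reindex (fun p => p.1) α ⊓ reindex (fun p => p.2) γ := by
  rw [compRel, ex_le_iff, reindex_inf, reindex_reindex, reindex_reindex]
  refine inf_le_inf ?_ ?_
  · simpa using reindex_mono (fun p : X × Y × Z => (p.1, p.2.1)) (hφ.trans inf_le_left)
  · simpa using reindex_mono (fun p : X × Y × Z => (p.2.1, p.2.2)) (hψ.trans inf_le_right)

/-- Introduction rule for `∃ y, φ (x, y)`. -/
theorem le_ex_fst {K X Y : Type u} {p : Pred A (X × Y)} {q : Pred A K} (h : K → X) (k : K → Y)
    (H : q ≤ reindex (fun x => (h x, k x)) p) :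
    q ≤ reindex h (ex (fun p => p.1) p) :=
  le_reindex_ex (f := fun p : X × Y => p.1) (fun x => (h x, k x)) (fun _ => rfl) H

/-- Elimination rule for `∃ y, φ (x, y)`. -/
theorem inf_ex_fst_le {K X Y : Type u} {p : Pred A (X × Y)} {q r : Pred A K} {h : K → X}
    (H : reindex (fun w : K × Y => w.1) q ⊓ reindex (fun w => (h w.1, w.2)) p ≤
      reindex (fun w => w.1) r) :
    q ⊓ reindex h (ex (fun p => p.1) p) ≤ r := by
  refine inf_reindex_ex_le ?_
  have := reindex_mono (fun w : {w : K × X × Y // w.2.1 = h w.1} => (w.1.1, w.1.2.2)) H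
  simp only [reindex_inf, reindex_reindex] at this
  have e : (fun w : {w : K × X × Y // w.2.1 = h w.1} => w.1.2) =
      fun w => (h w.1.1, w.1.2.2) := funext fun w => Prod.ext w.2 rfl
  rw [e]
  exact this

/-- Introduction rule for relational composition. -/
theorem le_compRel {K X Y Z : Type u} {φ : Pred A (X × Y)} {ψ : Pred A (Y × Z)} {q : Pred A K}
    {x : K → X} {z : K → Z} (y : K → Y) (h : q ≤ reindex (fun k => (x k, y k)) φ)
    (h' : q ≤ reindex (fun k => (y k, z k)) ψ) :
    q ≤ reindex (fun k => (x k, z k)) (compRel φ ψ) := by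
  refine le_reindex_ex (f := fun p : X × Y × Z => (p.1, p.2.2)) (fun k => (x k, y k, z k))
    (fun _ => rfl) ?_
  simp only [reindex_inf, reindex_reindex]
  exact le_inf h h'

/-- Elimination rule for relational composition. -/
theorem inf_compRel_le {K X Y Z : Type u} {φ : Pred A (X × Y)} {ψ : Pred A (Y × Z)}
    {q r : Pred A K} {x : K → X} {z : K → Z}
    (H : reindex (fun w : K × Y => w.1) q ⊓ (reindex (fun w => (x w.1, w.2)) φ ⊓
      reindex (fun w => (w.2, z w.1)) ψ) ≤ reindex (fun w => w.1) r) :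
    q ⊓ reindex (fun k => (x k, z k)) (compRel φ ψ) ≤ r := by
  refine inf_reindex_ex_le ?_
  have := reindex_mono (fun w : {w : K × X × Y × Z // (w.2.1, w.2.2.2) = (x w.1, z w.1)} =>
    (w.1.1, w.1.2.2.1)) H
  simp only [reindex_inf, reindex_reindex] at this ⊢
  have e : (fun w : {w : K × X × Y × Z // (w.2.1, w.2.2.2) = (x w.1, z w.1)} =>
      (w.1.2.1, w.1.2.2.1)) = fun w => (x w.1.1, w.1.2.2.1) :=
    funext fun w => Prod.ext (show w.1.2.1 = _ from congrArg Prod.fst w.2) rfl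
  have e' : (fun w : {w : K × X × Y × Z // (w.2.1, w.2.2.2) = (x w.1, z w.1)} =>
      (w.1.2.2.1, w.1.2.2.2)) = fun w => (w.1.2.2.1, z w.1.1) :=
    funext fun w => Prod.ext rfl (show w.1.2.2.2 = z w.1.1 from
      congrArg (fun p : X × Z => p.2) w.2)
  rw [e, e']
  exact this

theorem compRel_le {X Y Z : Type u} {φ : Pred A (X × Y)} {ψ : Pred A (Y × Z)}
    {r : Pred A (X × Z)}
    (H : reindex (fun w : (X × Z) × Y => (w.1.1, w.2)) φ ⊓
      reindex (fun w => (w.2, w.1.2)) ψ ≤ reindex (fun w => w.1) r) :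
    compRel φ ψ ≤ r := by
  have := inf_compRel_le (q := ⊤) (x := fun k : X × Z => k.1) (z := fun k => k.2)
    (inf_le_right.trans H)
  rw [top_inf_eq] at this
  exact (reindex_id _).ge.trans this

/-- Introduction rule for equality. -/
theorem le_eqPred {K Y : Type u} (q : Pred A K) (y : K → Y) :
    q ≤ reindex (fun k => (y k, y k)) (eqPred A Y) :=
  le_reindex_ex (f := fun y : Y => (y, y)) y (fun _ => rfl) le_top

/-- Substitution along the equality predicate. -/
theorem inf_eqPred_le {K Y : Type u} {u v : K → Y} {q r : Pred A K}
    (H : reindex (fun w : {x // u x = v x} => w.1) q ≤ reindex (fun w => w.1) r) :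
    q ⊓ reindex (fun x => (u x, v x)) (eqPred A Y) ≤ r := by
  refine inf_reindex_ex_le (inf_le_left.trans ?_)
  have := reindex_mono (fun w : {w : K × Y // (w.2, w.2) = (u w.1, v w.1)} =>
    (⟨w.1.1, (congrArg Prod.fst w.2).symm.trans (congrArg Prod.snd w.2)⟩ :
      {x // u x = v x})) H
  simpa using this

/-- Elimination rule for the graph of a function restricted to a predicate. -/
theorem inf_graph_le {K X Y : Type u} {f : X → Y} {α : Pred A X} {x : K → X} {y : K → Y}
    {q r : Pred A K}
    (H : reindex (fun w : {k // f (x k) = y k} => w.1) q ⊓ reindex (fun w => x w.1) α ≤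
      reindex (fun w => w.1) r) :
    q ⊓ reindex (fun k => (x k, y k)) (ex (fun x => (x, f x)) α) ≤ r := by
  refine inf_reindex_ex_le ?_
  have := reindex_mono (fun w : {w : K × X // (w.2, f w.2) = (x w.1, y w.1)} =>
    (⟨w.1.1, by
      have h1 := congrArg Prod.fst w.2
      have h2 := congrArg Prod.snd w.2
      exact (congrArg f h1).symm.trans h2⟩ : {k // f (x k) = y k})) H
  simp only [reindex_inf, reindex_reindex] at this
  have e : (fun w : {w : K × X // (w.2, f w.2) = (x w.1, y w.1)} => w.1.2) =
      fun w => x w.1.1 := funext fun w => congrArg Prod.fst w.2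
  rw [e]
  exact this

/-- Introduction rule for the graph of a function restricted to a predicate. -/
theorem le_graph {K X Y : Type u} {f : X → Y} {α : Pred A X} (x : K → X)
    {q : Pred A K} (H : q ≤ reindex x α) :
    q ≤ reindex (fun k => (x k, f (x k))) (ex (fun x => (x, f x)) α) :=
  le_reindex_ex (f := fun x => (x, f x)) x (fun _ => rfl) H

theorem comp_total {X Y Z : Type u} {α : Pred A X} {β : Pred A Y}
    {φ : Pred A (X × Y)} {ψ : Pred A (Y × Z)}
    (hφ : φ ≤ reindex (fun p => p.2) β) (hα : α ≤ ex (fun p => p.1) φ)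
    (hβ : β ≤ ex (fun p => p.1) ψ) :
    α ≤ ex (fun p => p.1) (compRel φ ψ) := by
  refine hα.trans (ex_le_iff.2 ?_)
  have h1 : φ ≤ φ ⊓ reindex (fun p => p.2) (ex (fun p => p.1) ψ) :=
    le_inf le_rfl (hφ.trans (reindex_mono _ hβ))
  refine h1.trans (inf_ex_fst_le ?_)
  rw [reindex_reindex]
  refine le_ex_fst (fun w : (X × Y) × Z => w.1.1) (fun w => w.2) ?_
  exact le_compRel (fun w => w.1.2) inf_le_left inf_le_right

/-- The functionality condition, instantiated at terms. -/
theorem functional_at {K X Y : Type u} {φ : Pred A (X × Y)}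
    (hφ : reindex (fun p : X × Y × Y => (p.1, p.2.1)) φ ⊓
      reindex (fun p => (p.1, p.2.2)) φ ≤ reindex (fun p => (p.2.1, p.2.2)) (eqPred A Y))
    (x : K → X) (y y' : K → Y) :
    reindex (fun k => (x k, y k)) φ ⊓ reindex (fun k => (x k, y' k)) φ ≤
      reindex (fun k => (y k, y' k)) (eqPred A Y) := by
  simpa using reindex_mono (fun k => (x k, y k, y' k)) hφ

theorem comp_functional {X Y Z : Type u} {φ : Pred A (X × Y)} {ψ : Pred A (Y × Z)}
    (hφ : reindex (fun p : X × Y × Y => (p.1, p.2.1)) φ ⊓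
      reindex (fun p => (p.1, p.2.2)) φ ≤ reindex (fun p => (p.2.1, p.2.2)) (eqPred A Y))
    (hψ : reindex (fun p : Y × Z × Z => (p.1, p.2.1)) ψ ⊓
      reindex (fun p => (p.1, p.2.2)) ψ ≤ reindex (fun p => (p.2.1, p.2.2)) (eqPred A Z)) :
    reindex (fun p : X × Z × Z => (p.1, p.2.1)) (compRel φ ψ) ⊓
      reindex (fun p => (p.1, p.2.2)) (compRel φ ψ) ≤
        reindex (fun p => (p.2.1, p.2.2)) (eqPred A Z) := by
  refine inf_compRel_le ?_
  rw [inf_comm, reindex_reindex]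
  refine inf_compRel_le ?_
  simp only [reindex_inf, reindex_reindex]
  have h := functional_at hφ (fun w : ((X × Z × Z) × Y) × Y => w.1.1.1) (fun w => w.1.2)
    (fun w => w.2)
  have h' : ∀ {q r : Pred A (((X × Z × Z) × Y) × Y)},
      q ≤ reindex (fun w => (w.1.1.1, w.1.2)) φ ⊓ reindex (fun w => (w.1.1.1, w.2)) φ →
      q ⊓ reindex (fun w => (w.1.2, w.2)) (eqPred A Y) ≤ r → q ≤ r :=
    fun hq hr => (le_inf le_rfl (hq.trans h)).trans hr
  refine h' (le_inf (inf_le_left.trans inf_le_left) (inf_le_right.trans inf_le_left)) ?_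
  refine inf_eqPred_le ?_
  simp only [reindex_inf, reindex_reindex]
  have k := functional_at hψ (fun w : {w : ((X × Z × Z) × Y) × Y // w.1.2 = w.2} => w.1.2)
    (fun w => w.1.1.1.2.1) (fun w => w.1.1.1.2.2)
  refine le_trans (le_inf (inf_le_right.trans inf_le_right)
    (inf_le_left.trans (inf_le_right.trans (le_of_eq ?_)))) k
  congr 1
  funext w
  exact Prod.ext w.2 rfl

/-- The graph of a function, as a morphism. -/
def graph {X Y : Reg A} (f : X.set → Y.set) (hf : X.pred ≤ reindex f Y.pred) : Hom X Y where
  rel := ex (fun x => (x, f x)) X.pred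
  le := by
    rw [ex_le_iff, reindex_inf, reindex_reindex, reindex_reindex]
    exact le_inf (reindex_id _).ge hf
  total := by
    refine (reindex_id X.pred).ge.trans (le_trans ?_ (reindex_id _).le)
    refine le_ex_fst (fun x => x) f ?_
    exact le_graph (fun x => x) le_rfl
  functional := by
    refine inf_graph_le ?_
    rw [inf_comm, reindex_reindex, inf_comm, inf_comm]
    refine inf_graph_le ?_
    simp only [reindex_reindex]
    have e : (fun w : {k : {k : X.set × Y.set × Y.set // f k.1 = k.2.2} // f k.1.1 = k.1.2.1} =>
      (w.1.1.2.1, w.1.1.2.2)) = fun w => (f w.1.1.1, f w.1.1.1) := by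
      funext w
      exact Prod.ext w.2.symm w.1.2.symm
    rw [e]
    exact le_eqPred _ _

instance : Category.{u} (Reg A) where
  Hom := Hom
  id X := graph (fun x => x) (reindex_id _).ge
  comp φ ψ :=
    { rel := compRel φ.rel ψ.rel
      le := comp_le φ.le ψ.le
      total := comp_total (φ.le.trans inf_le_right) φ.total ψ.total
      functional := comp_functional φ.functional ψ.functional }
  id_comp {X Y} φ := by
    apply Hom.ext
    apply le_antisymm
    · refine compRel_le ?_
      rw [inf_comm]
      refine inf_graph_le (f := fun x : X.set => x) ?_
      refine inf_le_left.trans (le_of_eq ?_)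
      simp only [reindex_reindex]
      congr 1
      funext w
      exact Prod.ext w.2.symm rfl
    · refine (reindex_id φ.rel).ge.trans (le_trans ?_ (reindex_id _).le)
      refine le_compRel (x := fun k : X.set × Y.set => k.1) (z := fun k => k.2)
        (fun w => w.1) ?_ le_rfl
      refine le_graph (f := fun x => x) (fun w : X.set × Y.set => w.1) ?_
      exact (reindex_id φ.rel).le.trans (φ.le.trans inf_le_left)
  comp_id {X Y} φ := by
    apply Hom.ext
    apply le_antisymm
    · refine compRel_le ?_
      refine inf_graph_le (f := fun x : Y.set => x) ?_
      refine inf_le_left.trans (le_of_eq ?_)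
      simp only [reindex_reindex]
      congr 1
      funext w
      exact Prod.ext rfl w.2
    · refine (reindex_id φ.rel).ge.trans (le_trans ?_ (reindex_id _).le)
      refine le_compRel (x := fun k : X.set × Y.set => k.1) (z := fun k => k.2)
        (fun w => w.2) le_rfl ?_
      refine le_graph (f := fun x => x) (fun w : X.set × Y.set => w.2) ?_
      exact (reindex_id φ.rel).le.trans (φ.le.trans inf_le_right)
  assoc {W X Y Z} φ ψ χ := by
    apply Hom.ext
    apply le_antisymm
    · refine compRel_le ?_
      rw [inf_comm]
      refine inf_compRel_le ?_
      simp only [reindex_reindex]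
      refine le_compRel (x := fun w : ((W.set × Z.set) × Y.set) × X.set => w.1.1.1)
        (z := fun w => w.1.1.2) (fun w => w.2) (inf_le_right.trans inf_le_left) ?_
      exact le_compRel (fun w => w.1.2) (inf_le_right.trans inf_le_right) inf_le_left
    · refine compRel_le ?_
      refine inf_compRel_le ?_
      simp only [reindex_reindex]
      refine le_compRel (x := fun w : ((W.set × Z.set) × X.set) × Y.set => w.1.1.1)
        (z := fun w => w.1.1.2) (fun w => w.2) ?_ (inf_le_right.trans inf_le_right)
      exact le_compRel (fun w => w.1.2) inf_le_left (inf_le_right.trans inf_le_left)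

end Reg

/-- The comparison functor from the Grothendieck category to the regular completion: the identity
on objects, sending `f : (X, α) ⟶ (Y, β)` to `∃_⟨id, f⟩ α`. -/
def Groth.toReg (A : Type u) [ImplicativeAlgebra A] : Groth A ⥤ Reg A where
  obj X := ⟨X.set, X.pred⟩
  map {X Y} f := Reg.graph (X := ⟨X.set, X.pred⟩) (Y := ⟨Y.set, Y.pred⟩) f.fn (Groth.Hom.le f)
  map_id X := rfl
  map_comp {X Y Z} f g := by
    apply Reg.Hom.ext
    apply le_antisymm
    · change ex (fun x => (x, g.fn (f.fn x))) X.pred ≤ Reg.compRel _ _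
      rw [ex_le_iff]
      refine Reg.le_compRel (x := fun x : X.set => x) (z := fun x => g.fn (f.fn x)) f.fn ?_ ?_
      · exact Reg.le_graph (fun x => x) (reindex_id _).ge
      · exact Reg.le_graph f.fn (Groth.Hom.le f)
    · change Reg.compRel _ _ ≤ ex (fun x => (x, g.fn (f.fn x))) X.pred
      refine Reg.compRel_le ?_
      rw [inf_comm]
      refine Reg.inf_graph_le (f := f.fn) ?_
      rw [inf_comm, reindex_reindex]
      refine Reg.inf_graph_le (f := g.fn) ?_
      refine inf_le_left.trans ?_
      simp only [reindex_reindex]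
      have e : (fun w : {w : {w : (X.set × Z.set) × Y.set // f.fn w.1.1 = w.2} //
          g.fn w.1.2 = w.1.1.2} => w.1.1.1) =
          fun w => (w.1.1.1.1, g.fn (f.fn w.1.1.1.1)) := by
        funext w
        refine Prod.ext rfl ?_
        rw [w.1.2]
        exact w.2.symm
      rw [e]
      exact Reg.le_graph (f := fun x => g.fn (f.fn x))
        (fun w : {w : {w : (X.set × Z.set) × Y.set // f.fn w.1.1 = w.2} //
          g.fn w.1.2 = w.1.1.2} => w.1.1.1.1) le_rfl

/-- An object `(X, φ)` of the Grothendieck category is a partitioned assembly if `φ` is a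
uniformly supercompact predicate. -/
def isPAsm (A : Type u) [ImplicativeAlgebra A] : ObjectProperty (Groth A) :=
  fun X => X.pred.IsUSK

/-- The category of partitioned assemblies, a full subcategory of the Grothendieck category. -/
abbrev PAsm (A : Type u) [ImplicativeAlgebra A] : Type (u + 1) := (isPAsm A).FullSubcategory

/-- The inclusion of partitioned assemblies into the Grothendieck category. -/
abbrev PAsm.toGroth (A : Type u) [ImplicativeAlgebra A] : PAsm A ⥤ Groth A := (isPAsm A).ι

/-- The inclusion of partitioned assemblies into the regular completion. -/
abbrev PAsm.toReg (A : Type u) [ImplicativeAlgebra A] : PAsm A ⥤ Reg A :=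
  PAsm.toGroth A ⋙ Groth.toReg A

/-- Partitioned assemblies form a lex full subcategory of the regular completion: the inclusion
is fully faithful, and partitioned assemblies have finite limits, which are the finite limits
of the Grothendieck category and are preserved by the inclusion into the regular completion. -/
structure PAsm.IsLexFullSubcategory (A : Type u) [ImplicativeAlgebra A] : Prop where
  full : (PAsm.toReg A).Full
  faithful : (PAsm.toReg A).Faithful
  hasFiniteLimits : HasFiniteLimits (PAsm A)
  preserves_groth : PreservesFiniteLimits (PAsm.toGroth A)
  preserves_reg : PreservesFiniteLimits (PAsm.toReg A)

end Categories

end ImplicativeAlgebra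

/-! ## Projective covers -/

/-- `P` is regular projective: morphisms out of `P` lift along regular epimorphisms. -/
def IsRegularProjective {C : Type u} [Category.{v} C] (P : C) : Prop :=
  ∀ ⦃X Y : C⦄ (e : X ⟶ Y) (f : P ⟶ Y), IsRegularEpi e → ∃ g : P ⟶ X, g ≫ e = f

/-- A (full) subcategory `ι : D ⥤ C` is a projective cover of `C` if its objects are regular
projective in `C` and every object of `C` is a regular quotient of one of them. -/
structure IsProjectiveCover {D : Type u} [Category.{v} D] {C : Type u} [Category.{v} C]
    (ι : D ⥤ C) : Prop where
  projective : ∀ X : D, IsRegularProjective (ι.obj X)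
  cover : ∀ Y : C, ∃ (X : D) (e : ι.obj X ⟶ Y), IsRegularEpi e

namespace ImplicativeAlgebra

/-! ## Supercompact families and supercompact predicates -/

section Families

variable {A : Type u} [ImplicativeAlgebra A]

/-! In the language of the tripos, uniform supercoherence says three things: `⊤` is U-SK over every
set, U-SK predicates are closed under binary meets, and every predicate is `∃_f` of a U-SK one
(`uniformlySupercoherent_iff`). The first two correspond to lexness, the third to the projective
cover.

The engine is that SK is an external choice principle. Totality of a relation out of an SK object is
an existential along a projection, so SK yields a section, and the relation is the graph of a
function (`Reg.exists_eq_ofFun`). That function is unique (`Reg.ofFun_injective`), so partitioned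
assemblies embed fully faithfully over any implicative algebra. Regular epimorphisms are internally
surjective (`Reg.pred_le_ex_of_isRegularEpi`), so SK also picks preimages and SK objects are
projective.

Conversely, an internally surjective function is the coequalizer of its kernel pair
(`Reg.isRegularEpi_ofFun`). Hence regular epimorphisms from partitioned assemblies onto `(J, p)`
amount to presentations `p = ∃_f q` with `q` U-SK.

As for limits, the Grothendieck category has terminal object `(1, ⊤)` and pullbacks carrying the
meet of the reindexed predicates, and the comparison functor preserves both. Closure of U-SK under
`⊤` and meets therefore makes partitioned assemblies closed under finite limits. In the other
direction, `⊤` over `K` and `p ⊓ q` are reindexings of the predicates of a terminal object and of a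
binary product of partitioned assemblies, and U-SK is stable under reindexing. -/

theorem top_mem_sep : (⊤ : A) ∈ (sep : Set A) :=
  sep_up (ent_refl (⊤ : A)) le_top

theorem top_ent_iff_mem {c : A} : Ent ⊤ c ↔ c ∈ (sep : Set A) :=
  ⟨fun h => sep_mp h top_mem_sep, ent_of_mem ⊤⟩

/-- The fibre of `Σ i, J i → I` over `i` is `J i`. This links the indexed families of `SK` with the
functions `J → I` of `IsSK`. -/
theorem bigExists_sigma_fiber {I : Type u} {J : I → Type u} (b : ∀ i, J i → A) (i : I) :
    (bigExists fun j : {j : Σ i, J i // j.1 = i} => b j.1.1 j.1.2) = bigExists (b i) := by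
  refine iInf_congr fun x => congrArg (fun z => z ⇝ x) ?_
  apply le_antisymm
  · exact le_iInf fun j =>
      iInf_le (fun j : {j : Σ i, J i // j.1 = i} => b j.1.1 j.1.2 ⇝ x) ⟨⟨i, j⟩, rfl⟩
  · refine le_iInf ?_
    rintro ⟨⟨i, j⟩, rfl⟩
    exact iInf_le (fun j => b i j ⇝ x) j

theorem isSK_mk_iff {I : Type u} {a : I → A} : (Pred.mk a).IsSK ↔ SK a := by
  constructor
  · intro h J b hb
    obtain ⟨g, hg, hgf⟩ := h (Σ i, J i) (fun j => j.1) (Pred.mk fun j => b j.1 j.2) (by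
      change (⨅ i, a i ⇝ bigExists fun j : {j : Σ i, J i // j.1 = i} => b j.1.1 j.1.2) ∈ sep
      simpa only [bigExists_sigma_fiber] using hb)
    -- `(g i).2` lives in `J (g i).1`, where `(g i).1 = i` is only propositional. Generalizing `g i`
    -- to a variable allows the transport.
    have H : ∀ i, ∃ j, b (g i).1 (g i).2 = b i j := fun i => by
      obtain ⟨k, hk⟩ : ∃ k, k = g i := ⟨_, rfl⟩
      have h' := hgf i
      rw [← hk] at h' ⊢
      subst h'
      exact ⟨k.2, rfl⟩
    choose f hf using H
    refine ⟨f, ?_⟩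
    have hg' : (⨅ i, a i ⇝ b (g i).1 (g i).2) ∈ (sep : Set A) := hg
    simpa only [hf] using hg'
  · intro h J f q hq
    induction q using Quotient.inductionOn with
    | h θ =>
      obtain ⟨g, hg⟩ := h (fun i => {j // f j = i}) (fun i j => θ j.1) hq
      exact ⟨fun i => (g i).1, hg, fun i => (g i).2⟩

theorem isUSK_mk_iff {I : Type u} {a : I → A} : (Pred.mk a).IsUSK ↔ USK a :=
  forall_congr' fun _ => forall_congr' fun f => isSK_mk_iff (a := a ∘ f)

theorem choiceRule_iff_isSK_top :
    ChoiceRule A ↔ ∀ K : Type u, (⊤ : Pred A K).IsSK := by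
  refine forall_congr' fun K => ?_
  change _ ↔ (Pred.mk fun _ : K => (⊤ : A)).IsSK
  rw [isSK_mk_iff]
  -- This is `top_ent_iff_mem` in the power algebra `K → A`, whose separator consists of the
  -- families with meet in `sep`.
  have key : ∀ c : K → A, (⨅ k, ⊤ ⇝ c k) ∈ (sep : Set A) ↔ (⨅ k, c k) ∈ (sep : Set A) := fun c =>
    top_ent_iff_mem (c := c)
  simp only [SK, key]

namespace Pred

theorem IsUSK.reindex {I J : Type u} {p : Pred A I} (hp : p.IsUSK) (f : J → I) :
    (reindex f p).IsUSK := fun K g => by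
  rw [reindex_reindex]
  exact hp K _

theorem IsUSK.isSK {I : Type u} {p : Pred A I} (hp : p.IsUSK) : p.IsSK := by
  simpa only [reindex_id] using hp I fun i => i

end Pred

theorem uniformlySupercoherent_iff :
    UniformlySupercoherent A ↔
      (∀ K : Type u, (⊤ : Pred A K).IsUSK) ∧
      (∀ (I : Type u) (p q : Pred A I), p.IsUSK → q.IsUSK → (p ⊓ q).IsUSK) ∧
      ∀ (J : Type u) (p : Pred A J), ∃ (I : Type u) (f : I → J) (q : Pred A I),
        q.IsUSK ∧ p = Pred.ex f q := by
  constructor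
  · intro h
    -- Reindexing `⊤` gives `⊤` definitionally, so SK over every set is already U-SK.
    refine ⟨fun K L f => choiceRule_iff_isSK_top.1 h.choice L, fun I p q hp hq => ?_,
      fun J p => ?_⟩
    · induction p using Quotient.inductionOn
      induction q using Quotient.inductionOn
      exact isUSK_mk_iff.2 (h.conj _ _ _ (isUSK_mk_iff.1 hp) (isUSK_mk_iff.1 hq))
    · induction p using Quotient.inductionOn with
      | h a =>
        obtain ⟨I, f, b, hb, h1, h2⟩ := h.cover J a
        exact ⟨I, f, Pred.mk b, isUSK_mk_iff.2 hb, Quotient.sound ⟨h1, h2⟩⟩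
  · rintro ⟨h1, h2, h3⟩
    refine ⟨choiceRule_iff_isSK_top.2 fun K => (h1 K).isSK, fun I a b ha hb => ?_, fun J a => ?_⟩
    · exact isUSK_mk_iff.1 (h2 I _ _ (isUSK_mk_iff.2 ha) (isUSK_mk_iff.2 hb))
    · obtain ⟨I, f, q, hq, e⟩ := h3 J (Pred.mk a)
      induction q using Quotient.inductionOn with
      | h b =>
        have e' : Ent a _ ∧ Ent _ a := Quotient.exact e
        exact ⟨I, f, b, isUSK_mk_iff.1 hq, e'.1, e'.2⟩

end Families

/-! ## Reasoning with generalized elements -/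

section Generalized

open ImplicativeAlgebra.Pred

variable {A : Type u} [ImplicativeAlgebra A] {I J K L : Type u}

/-- Read `q ≤ reindex x p` as: at stage `K`, under hypothesis `q`, the generalized element `x`
satisfies `p`. Such judgements are stable under a change of stage `s`. -/
theorem Pred.le_reindex_trans {q : Pred A K} {q' : Pred A L} {s : L → K} {x : K → I} {p : Pred A I}
    (hs : q' ≤ reindex s q) (h : q ≤ reindex x p) : q' ≤ reindex (fun k => x (s k)) p := by
  simpa using hs.trans (reindex_mono s h)

/-- An existential hypothesis may be eliminated by passing to a further stage that carries a
witness. -/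
theorem Pred.ex_elim {q r : Pred A K} {f : J → I} {h : K → I} {p : Pred A J}
    (hq : q ≤ reindex h (ex f p))
    (H : ∀ (L : Type u) (s : L → K) (j : L → J) (q' : Pred A L), (∀ l, f (j l) = h (s l)) →
      q' ≤ reindex s q → q' ≤ reindex j p → q' ≤ reindex s r) : q ≤ r :=
  (le_inf le_rfl hq).trans <| inf_reindex_ex_le <| by
    exact H {w : K × J // f w.2 = h w.1} (fun w => w.1.1) (fun w => w.1.2) _ (fun w => w.2) inf_le_left inf_le_right

/-- Since `eqPred` is an existential along the diagonal, internal equality becomes equality of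
functions at the stage `{k // u k = v k}`. -/
theorem Pred.eqPred_elim {q r : Pred A K} {u v : K → I}
    (hq : q ≤ reindex (fun k => (u k, v k)) (eqPred A I))
    (H : ∀ (L : Type u) (s : L → K) (q' : Pred A L), (∀ l, u (s l) = v (s l)) →
      q' ≤ reindex s q → q' ≤ reindex s r) : q ≤ r :=
  (le_inf le_rfl hq).trans <| Reg.inf_eqPred_le <| by
    exact H {k // u k = v k} (fun w => w.1) _ (fun w => w.2) le_rfl

theorem Pred.le_of_generalized {p q : Pred A I}
    (H : ∀ (K : Type u) (x : K → I) (r : Pred A K), r ≤ reindex x p → r ≤ reindex x q) :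
    p ≤ q := by
  simpa using H I (fun i => i) p (by simp)

namespace Reg

variable {X Y Z : Reg A}

theorem rel_dom (φ : X ⟶ Y) {q : Pred A K} {x : K → X.set} {y : K → Y.set}
    (h : q ≤ reindex (fun k => (x k, y k)) φ.rel) : q ≤ reindex x X.pred := by
  simpa using le_reindex_trans h ((Hom.le φ).trans inf_le_left)

theorem rel_cod (φ : X ⟶ Y) {q : Pred A K} {x : K → X.set} {y : K → Y.set}
    (h : q ≤ reindex (fun k => (x k, y k)) φ.rel) : q ≤ reindex y Y.pred := by
  simpa using le_reindex_trans h ((Hom.le φ).trans inf_le_right)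

theorem total_elim (φ : X ⟶ Y) {q r : Pred A K} {x : K → X.set} (h : q ≤ reindex x X.pred)
    (H : ∀ (L : Type u) (s : L → K) (y : L → Y.set) (q' : Pred A L), q' ≤ reindex s q →
      q' ≤ reindex (fun l => (x (s l), y l)) φ.rel → q' ≤ reindex s r) : q ≤ r := by
  refine ex_elim (le_reindex_trans h ((reindex_id _).ge.trans
    (reindex_mono (fun x => x) φ.total))) fun L s j q' e hs hj => ?_
  refine H L s (fun l => (j l).2) q' hs ?_
  have : j = fun l => (x (s l), (j l).2) := funext fun l => Prod.ext (e l) rfl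
  rwa [this] at hj

theorem functional_elim (φ : X ⟶ Y) {q r : Pred A K} {x : K → X.set} {y y' : K → Y.set}
    (h : q ≤ reindex (fun k => (x k, y k)) φ.rel) (h' : q ≤ reindex (fun k => (x k, y' k)) φ.rel)
    (H : ∀ (L : Type u) (s : L → K) (q' : Pred A L), (∀ l, y (s l) = y' (s l)) →
      q' ≤ reindex s q → q' ≤ reindex s r) : q ≤ r :=
  eqPred_elim ((le_inf h h').trans (functional_at φ.functional x y y')) H

theorem comp_elim (φ : X ⟶ Y) (ψ : Y ⟶ Z) {q r : Pred A K} {x : K → X.set} {z : K → Z.set}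
    (h : q ≤ reindex (fun k => (x k, z k)) (φ ≫ ψ).rel)
    (H : ∀ (L : Type u) (s : L → K) (y : L → Y.set) (q' : Pred A L), q' ≤ reindex s q →
      q' ≤ reindex (fun l => (x (s l), y l)) φ.rel →
      q' ≤ reindex (fun l => (y l, z (s l))) ψ.rel → q' ≤ reindex s r) : q ≤ r :=
  (le_inf le_rfl h).trans <| inf_compRel_le <| by
    exact H (K × Y.set) (fun w => w.1) (fun w => w.2) _ inf_le_left
      (inf_le_right.trans inf_le_left) (inf_le_right.trans inf_le_right)

theorem comp_intro (φ : X ⟶ Y) (ψ : Y ⟶ Z) {q : Pred A K} {x : K → X.set} {y : K → Y.set}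
    {z : K → Z.set} (h : q ≤ reindex (fun k => (x k, y k)) φ.rel)
    (h' : q ≤ reindex (fun k => (y k, z k)) ψ.rel) :
    q ≤ reindex (fun k => (x k, z k)) (φ ≫ ψ).rel :=
  le_compRel y h h'

/-- The graph of a function, as a morphism of `Reg A`. -/
abbrev ofFun (f : X.set → Y.set) (hf : X.pred ≤ reindex f Y.pred) : X ⟶ Y := graph f hf

theorem ofFun_elim {f : X.set → Y.set} {hf : X.pred ≤ reindex f Y.pred} {q r : Pred A K}
    {x : K → X.set} {y : K → Y.set} (h : q ≤ reindex (fun k => (x k, y k)) (ofFun f hf).rel)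
    (H : ∀ (L : Type u) (s : L → K) (q' : Pred A L), (∀ l, f (x (s l)) = y (s l)) →
      q' ≤ reindex s q → q' ≤ reindex s r) : q ≤ r :=
  (le_inf le_rfl h).trans <| inf_graph_le <| inf_le_left.trans <| by
    exact H {k // f (x k) = y k} (fun w => w.1) _ (fun w => w.2) le_rfl

theorem ofFun_intro {f : X.set → Y.set} {hf : X.pred ≤ reindex f Y.pred} {q : Pred A K}
    {x : K → X.set} {y : K → Y.set} (h : q ≤ reindex x X.pred) (e : ∀ k, f (x k) = y k) :
    q ≤ reindex (fun k => (x k, y k)) (ofFun f hf).rel := by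
  obtain rfl : (fun k => f (x k)) = y := funext e
  exact le_graph x h

/-- Parallel functional relations that are comparable are equal. -/
theorem hom_eq_of_le {φ ψ : X ⟶ Y}
    (H : ∀ (K : Type u) (x : K → X.set) (y : K → Y.set) (q : Pred A K),
      q ≤ reindex (fun k => (x k, y k)) φ.rel → q ≤ reindex (fun k => (x k, y k)) ψ.rel) :
    φ = ψ := by
  apply Hom.ext
  refine le_antisymm (le_of_generalized fun K x r => H K (fun k => (x k).1) (fun k => (x k).2) r)
    (le_of_generalized fun K x r hr => ?_)
  -- For the reverse inclusion, a `φ`-value of the same argument is also a `ψ`-value, hence equal to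
  -- the given one by functionality of `ψ`.
  refine total_elim φ (x := fun k => (x k).1) (rel_dom ψ (y := fun k => (x k).2) hr)
    fun L s y q' hs hy => ?_
  have hs' := le_reindex_trans hs hr
  refine functional_elim ψ (x := fun l => (x (s l)).1) (y := fun l => (x (s l)).2)
    hs' (H L _ _ _ hy) fun M t q'' e ht => ?_
  have h' := le_reindex_trans ht hy
  rw [reindex_reindex, reindex_reindex]
  have e' : (fun m => x (s (t m))) = fun m => ((x (s (t m))).1, y (t m)) :=
    funext fun m => Prod.ext rfl (e m)
  rw [e']
  exact h'

end Reg

end Generalized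

/-! ## Morphisms of the regular completion out of supercompact objects -/

section RegularCompletion

open ImplicativeAlgebra.Pred

variable {A : Type u} [ImplicativeAlgebra A]

namespace Reg

variable {X Y Z V : Reg A}

theorem id_intro {K : Type u} {q : Pred A K} {x : K → X.set} (h : q ≤ reindex x X.pred) :
    q ≤ reindex (fun k => (x k, x k)) (Hom.rel (𝟙 X)) :=
  ofFun_intro (X := X) (Y := X) (f := fun x => x) (hf := (reindex_id _).ge) h fun _ => rfl

/-- A morphism containing the graph of a function is that graph. -/
theorem ofFun_eq_of_le {f : X.set → Y.set} {hf : X.pred ≤ reindex f Y.pred} {φ : X ⟶ Y}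
    (h : X.pred ≤ reindex (fun x => (x, f x)) φ.rel) : ofFun f hf = φ := by
  refine hom_eq_of_le fun K x y q hq => ?_
  refine ofFun_elim hq fun L s q' e hs => ?_
  have e' : (fun l => (x (s l), y (s l))) = fun l => (x (s l), f (x (s l))) :=
    funext fun l => Prod.ext rfl (e l).symm
  rw [reindex_reindex, e']
  exact le_reindex_trans (le_reindex_trans hs (rel_dom _ hq)) h

theorem ofFun_comp_ofFun {f : X.set → Y.set} {hf : X.pred ≤ reindex f Y.pred}
    {g : Y.set → Z.set} {hg : Y.pred ≤ reindex g Z.pred} :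
    ofFun f hf ≫ ofFun g hg = ofFun (fun x => g (f x))
      (le_reindex_trans hf hg) := by
  refine (ofFun_eq_of_le ?_).symm
  exact comp_intro (ofFun f hf) (ofFun g hg) (x := fun x => x)
    (ofFun_intro (reindex_id _).ge fun _ => rfl) (ofFun_intro hf fun _ => rfl)

/-- Functional relations out of a supercompact object are graphs. -/
theorem exists_eq_ofFun (hX : X.pred.IsSK) (φ : X ⟶ Y) :
    ∃ (f : X.set → Y.set) (hf : X.pred ≤ reindex f Y.pred), φ = ofFun f hf := by
  -- SK applied to totality gives a strict section of the first projection; its second component is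
  -- the required function.
  obtain ⟨g, hg, hgs⟩ := hX _ (fun p => p.1) φ.rel φ.total
  have e : g = fun x => (x, (g x).2) := funext fun x => Prod.ext (hgs x) rfl
  rw [e] at hg
  exact ⟨fun x => (g x).2, rel_cod φ (x := fun x => x) hg, (ofFun_eq_of_le hg).symm⟩

/-- Functions out of a supercompact object with the same graph are equal. -/
theorem ofFun_injective (hX : X.pred.IsSK) {f f' : X.set → Y.set}
    {hf : X.pred ≤ reindex f Y.pred} {hf' : X.pred ≤ reindex f' Y.pred}
    (h : ofFun f hf = ofFun f' hf') : f = f' := by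
  have h1 : X.pred ≤ reindex (fun x => (x, f' x)) (ofFun f hf).rel := by
    rw [h]
    exact ofFun_intro (x := fun x => x) (reindex_id _).ge fun _ => rfl
  -- The existential runs along the inclusion of the equalizer. A section of this inclusion forces
  -- `f x = f' x` at every point, whatever the truth value of `X.pred` there.
  have h2 : X.pred ≤ ex (fun x : {x // f x = f' x} => x.1) (reindex (fun x => x.1) X.pred) := by
    refine ofFun_elim (x := fun x => x) h1 fun L s q' e hs => ?_
    refine le_reindex_ex (f := fun x : {x // f x = f' x} => x.1) (fun l => ⟨s l, e l⟩)
      (fun _ => rfl) ?_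
    rwa [reindex_reindex]
  obtain ⟨g, -, hg⟩ := hX _ _ _ h2
  funext x
  have := (g x).2
  rwa [hg x] at this

/-! ### Regular epimorphisms -/

/-- Regular epimorphisms are surjective in the internal sense. -/
theorem pred_le_ex_of_isRegularEpi (φ : X ⟶ Y) [IsRegularEpi φ] :
    Y.pred ≤ ex (fun p => p.2) φ.rel := by
  -- The image of `φ` as a subobject of `Y`. The aim is a section of its inclusion `m`, which forces
  -- it to be all of `Y`.
  let I : Reg A := ⟨Y.set, ex (fun p => p.2) φ.rel⟩
  have hI : I.pred ≤ Y.pred := ex_le_iff.2 ((Hom.le φ).trans inf_le_right)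
  let m : I ⟶ Y := ofFun (fun y => y) (hI.trans (reindex_id _).ge)
  let e : X ⟶ I :=
    { rel := φ.rel
      le := le_inf ((Hom.le φ).trans inf_le_left) (ex_le_iff.1 le_rfl)
      total := φ.total
      functional := φ.functional }
  have hem : e ≫ m = φ := by
    refine (hom_eq_of_le fun K x y q hq => ?_).symm
    exact comp_intro e m (y := y) hq
      (ofFun_intro (rel_cod e (x := x) hq) fun _ => rfl)
  -- `e` and `φ` have the same relation and composition sees only relations, so `e` coequalizes the
  -- pair that `φ` does.
  have hw : IsRegularEpi.left φ ≫ e = IsRegularEpi.right φ ≫ e :=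
    Hom.ext (congrArg Hom.rel (IsRegularEpi.w φ) :)
  have hk := IsRegularEpi.fac φ e hw
  set k : Y ⟶ I := IsRegularEpi.desc φ e hw
  have : Epi φ := (IsRegularEpi.getStruct φ).epi
  have hkm : k ≫ m = 𝟙 Y := by
    rw [← cancel_epi φ, ← Category.assoc, hk, hem, Category.comp_id]
  have h1 : Y.pred ≤ reindex (fun y : Y.set => (y, y)) (Hom.rel (k ≫ m)) := by
    rw [hkm]
    exact id_intro (x := fun y => y) (reindex_id _).ge
  -- As `k ≫ m` is the identity and `m` is a graph of the identity function, `k` relates each `y` to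
  -- itself; its codomain bound then puts `y` in the image.
  refine comp_elim k m (x := fun y => y) (z := fun y => y) h1 fun L s y q' hs hk hm => ?_
  refine ofFun_elim hm fun M t q'' e ht => ?_
  have := le_reindex_trans ht (rel_cod k hk)
  rw [reindex_reindex]
  rwa [show (fun l => y (t l)) = fun l => s (t l) from funext e] at this

/-! ### Internally surjective functions as coequalizers -/

section Descent

variable {f : X.set → Y.set} (hf : X.pred ≤ reindex f Y.pred)

/-- A morphism compatible with a surjective function descends along it. -/
def descend (h : Y.pred ≤ ex f X.pred) (χ : X ⟶ V)
    (hχ : ∀ (K : Type u) (q : Pred A K) (x x' : K → X.set) (v : K → V.set),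
      (∀ k, f (x k) = f (x' k)) → q ≤ reindex x' X.pred →
      q ≤ reindex (fun k => (x k, v k)) χ.rel → q ≤ reindex (fun k => (x' k, v k)) χ.rel) :
    Y ⟶ V where
  rel := ex (fun p : X.set × V.set => (f p.1, p.2)) χ.rel
  le := by
    rw [ex_le_iff, reindex_inf, reindex_reindex, reindex_reindex]
    refine (Hom.le χ).trans (inf_le_inf_right _ ?_)
    simpa using reindex_mono (fun p : X.set × V.set => p.1) hf
  total := by
    refine ex_elim (h := fun y => y) (h.trans (reindex_id _).ge) fun L s j q' e hs hj => ?_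
    refine total_elim χ hj fun M t v q'' ht hv => ?_
    rw [reindex_reindex]
    refine le_ex_fst _ v (le_reindex_ex (fun m => (j (t m), v m)) ?_ hv)
    intro m
    rw [e]
  functional := by
    refine ex_elim (inf_le_left (α := Pred A (Y.set × V.set × V.set)))
      fun L s j q' e hs hj => ?_
    refine ex_elim (h := fun l => ((s l).1, (s l).2.2))
      (le_reindex_trans hs (inf_le_right (α := Pred A (Y.set × V.set × V.set))))
      fun M t i q'' e' ht hi => ?_
    have hj' := le_reindex_trans ht hj
    -- Two values over one point of `Y` may come from different preimages; compatibility moves the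
    -- second to the first preimage, where `χ` is functional.
    have h1 : q'' ≤ reindex (fun m => ((j (t m)).1, (i m).2)) χ.rel :=
      hχ M q'' (fun m => (i m).1) (fun m => (j (t m)).1) (fun m => (i m).2)
        (fun m => (congrArg Prod.fst (e' m)).trans (congrArg Prod.fst (e (t m))).symm)
        (rel_dom χ (y := fun m => (j (t m)).2) hj') hi
    refine functional_elim χ (y := fun m => (j (t m)).2) hj' h1 fun N r q₃ e'' hr => ?_
    simp only [reindex_reindex]
    have e₃ : (fun n => ((s (t (r n))).2.1, (s (t (r n))).2.2)) =
        fun n => ((s (t (r n))).2.1, (s (t (r n))).2.1) := by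
      funext n
      refine Prod.ext rfl ?_
      have a := congrArg Prod.snd (e' (r n))
      have b := congrArg Prod.snd (e (t (r n)))
      exact a.symm.trans ((e'' n).symm.trans b)
    rw [e₃]
    exact le_eqPred _ _

/-- Functions that are surjective in the internal sense are regular epimorphisms. -/
theorem isRegularEpi_ofFun (h : Y.pred ≤ ex f X.pred) : IsRegularEpi (ofFun f hf) := by
  -- The kernel pair of `f`, consisting of the pairs that `f` identifies on the nose.
  let W : Reg A := ⟨{p : X.set × X.set // f p.1 = f p.2},
    reindex (fun p => p.1.1) X.pred ⊓ reindex (fun p => p.1.2) X.pred⟩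
  let l : W ⟶ X := ofFun (fun p => p.1.1) inf_le_left
  let r : W ⟶ X := ofFun (fun p => p.1.2) inf_le_right
  have w : l ≫ ofFun f hf = r ≫ ofFun f hf := by
    rw [ofFun_comp_ofFun, ofFun_comp_ofFun]
    congr 1
    exact funext fun p => p.2
  refine ⟨⟨⟨W, l, r, w, Cofork.IsColimit.mk' _ fun c => ?_⟩⟩⟩
  have hc : l ≫ c.π = r ≫ c.π := c.condition
  refine ⟨descend hf h c.π fun K q x x' v e hx' hx => ?_, ?_, fun {m} hm => ?_⟩
  · have h1 : q ≤ reindex (fun k => ((⟨(x k, x' k), e k⟩ : W.set), v k)) (l ≫ c.π).rel := by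
      refine comp_intro l c.π (y := x) (ofFun_intro ?_ fun _ => rfl) hx
      simp only [W, reindex_inf, reindex_reindex]
      exact le_inf (rel_dom c.π hx) hx'
    rw [hc] at h1
    refine comp_elim r c.π h1 fun L s y q' hs hy hv => ?_
    refine ofFun_elim hy fun M t q'' e' ht => ?_
    have := le_reindex_trans ht hv
    rw [reindex_reindex, reindex_reindex]
    have e₂ : (fun m => y (t m)) = fun m => x' (s (t m)) := funext fun m => (e' m).symm
    have e₃ : (fun m => (y (t m), v (s (t m)))) = fun m => (x' (s (t m)), v (s (t m))) :=
      funext fun m => Prod.ext (congrFun e₂ m) rfl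
    rwa [e₃] at this
  · refine (hom_eq_of_le fun K x y q hq => ?_).symm
    refine comp_intro (ofFun f hf) _ (y := fun k => f (x k))
      (ofFun_intro (rel_dom c.π hq) fun _ => rfl) ?_
    exact le_reindex_ex (f := fun p : X.set × c.pt.set => (f p.1, p.2)) (fun k => (x k, y k))
      (fun _ => rfl) hq
  -- For uniqueness one inclusion suffices: the descended relation lies in `m`, since a `χ`-value at
  -- a preimage is an `m`-value at its image.
  · refine (hom_eq_of_le fun K y v q hq => ?_).symm
    refine ex_elim hq fun L s j q' e hs hj => ?_
    have h1 : q' ≤ reindex (fun l => ((j l).1, (j l).2)) (ofFun f hf ≫ m).rel :=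
      hj.trans (congrArg (fun φ => reindex j (Hom.rel φ)) hm).ge
    refine comp_elim (ofFun f hf) m h1 fun M t z q'' ht hz hv => ?_
    refine ofFun_elim hz fun N r q₃ e' hr => ?_
    have := le_reindex_trans hr hv
    simp only [reindex_reindex]
    have e₂ : (fun n => (z (r n), (j (t (r n))).2)) =
        fun n => (y (s (t (r n))), v (s (t (r n)))) := by
      funext n
      rw [← e' n]
      exact e (t (r n))
    rwa [e₂] at this

end Descent

theorem isRegularProjective (hX : X.pred.IsSK) : IsRegularProjective X := by
  intro Y Z φ ψ hφ
  obtain ⟨f, hf, rfl⟩ := exists_eq_ofFun hX ψ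
  -- Every `f x` has a `φ`-preimage internally. Phrased over the projection to `X`, SK turns this
  -- into a function choosing preimages, which is the lift.
  have h1 : X.pred ≤ ex (fun w : X.set × Y.set => w.1)
      (reindex (fun w => (w.2, f w.1)) φ.rel) := by
    refine ex_elim (hf.trans (reindex_mono f (pred_le_ex_of_isRegularEpi φ)))
      fun L s j q' e hs hj => ?_
    refine le_ex_fst s (fun l => (j l).1) ?_
    rw [reindex_reindex]
    have e' : j = fun l => ((j l).1, f (s l)) := funext fun l => Prod.ext rfl (e l)
    rwa [e'] at hj
  obtain ⟨g, hg, hgs⟩ := hX _ _ _ h1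
  have hg' : X.pred ≤ reindex (fun x => ((g x).2, f x)) φ.rel := by
    rw [reindex_reindex] at hg
    simpa only [hgs] using hg
  refine ⟨ofFun (fun x => (g x).2) (rel_dom φ hg'), (ofFun_eq_of_le ?_).symm⟩
  exact comp_intro _ φ (x := fun x => x) (ofFun_intro (reindex_id _).ge fun _ => rfl) hg'

end Reg

end RegularCompletion

/-! ## Finite limits -/

section FiniteLimits

open ImplicativeAlgebra.Pred

variable {A : Type u} [ImplicativeAlgebra A]

/-! ### Terminal object and pullbacks of the Grothendieck category -/

namespace Groth

variable {X Y Z : Groth A}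

/-- The terminal object. -/
def terminalObj (A : Type u) [ImplicativeAlgebra A] : Groth A := ⟨PUnit, ⊤⟩

/-- `terminalObj A` is terminal. -/
def isTerminalTerminalObj : IsTerminal (terminalObj A) :=
  IsTerminal.ofUniqueHom (fun _ => ⟨fun _ => PUnit.unit, le_top⟩) fun _ _ => rfl

section Pullback

variable (f : X ⟶ Z) (g : Y ⟶ Z)

/-- The pullback of two morphisms. -/
def pullbackObj : Groth A :=
  ⟨{p : X.set × Y.set // f.fn p.1 = g.fn p.2},
    reindex (fun p => p.1.1) X.pred ⊓ reindex (fun p => p.1.2) Y.pred⟩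

/-- The first projection of the pullback. -/
def pullbackFst : pullbackObj f g ⟶ X := ⟨fun p => p.1.1, inf_le_left⟩

/-- The second projection of the pullback. -/
def pullbackSnd : pullbackObj f g ⟶ Y := ⟨fun p => p.1.2, inf_le_right⟩

theorem pullback_condition : pullbackFst f g ≫ f = pullbackSnd f g ≫ g :=
  Hom.ext (funext fun p => p.2)

variable {f g} in
/-- The morphism into the pullback induced by a commutative square. -/
def pullbackLift {W : Groth A} (h : W ⟶ X) (k : W ⟶ Y) (e : h ≫ f = k ≫ g) :
    W ⟶ pullbackObj f g where
  fn w := ⟨(h.fn w, k.fn w), congrFun (congrArg Hom.fn e) w⟩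
  le := by
    simp only [pullbackObj, reindex_inf, reindex_reindex]
    exact le_inf (Hom.le h) (Hom.le k)

/-- The universal property of the pullback. -/
def isLimitPullback : IsLimit (PullbackCone.mk _ _ (pullback_condition f g)) :=
  PullbackCone.isLimitAux' _ fun s =>
    ⟨pullbackLift s.fst s.snd s.condition, rfl, rfl, fun h h' => Hom.ext (funext fun w => Subtype.ext (Prod.ext
        (congrFun (congrArg Hom.fn h) w) (congrFun (congrArg Hom.fn h') w)))⟩

end Pullback

instance : HasTerminal (Groth A) := isTerminalTerminalObj.hasTerminal

instance : HasPullbacks (Groth A) :=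
  @hasPullbacks_of_hasLimit_cospan _ _ fun {_ _ _ f g} => ⟨⟨⟨_, isLimitPullback f g⟩⟩⟩

end Groth

/-! ### Pullbacks of graphs in the regular completion -/

namespace Reg

variable {X Y Z : Reg A}

/-- The graphs of a pullback square of functions form a pullback square when the vertex carries the
meet of the reindexed predicates. -/
theorem exists_pullback_lift {W : Reg A} {f : X.set → Z.set} {hf : X.pred ≤ reindex f Z.pred}
    {g : Y.set → Z.set} {hg : Y.pred ≤ reindex g Z.pred} {P : Reg A}
    {p : P.set → X.set} {hp : P.pred ≤ reindex p X.pred}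
    {q : P.set → Y.set} {hq : P.pred ≤ reindex q Y.pred}
    (hP : reindex p X.pred ⊓ reindex q Y.pred ≤ P.pred)
    (hinj : ∀ a b, p a = p b → q a = q b → a = b)
    (hsurj : ∀ x y, f x = g y → ∃ a, p a = x ∧ q a = y)
    (h : W ⟶ X) (k : W ⟶ Y) (e : h ≫ ofFun f hf = k ≫ ofFun g hg) :
    ∃ l : W ⟶ P, l ≫ ofFun p hp = h ∧ l ≫ ofFun q hq = k ∧
      ∀ m : W ⟶ P, m ≫ ofFun p hp = h → m ≫ ofFun q hq = k → m = l := by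
  -- The lift relates `w` to `a` when `h` relates `w` to `p a` and `k` relates `w` to `q a`.
  let l : W ⟶ P :=
    { rel := reindex (fun w => (w.1, p w.2)) h.rel ⊓ reindex (fun w => (w.1, q w.2)) k.rel
      le := by
        refine le_inf (inf_le_left.trans (rel_dom h (x := fun w : W.set × P.set => w.1) le_rfl)) ?_
        refine (inf_le_inf (rel_cod h (y := fun w : W.set × P.set => p w.2) le_rfl)
          (rel_cod k (y := fun w : W.set × P.set => q w.2) le_rfl)).trans ?_
        simpa using reindex_mono (fun w : W.set × P.set => w.2) hP
      total := by
        refine total_elim h (x := fun w => w) (reindex_id _).ge fun L s x r hr hx => ?_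
        have h1 : r ≤ reindex (fun l => (s l, f (x l))) (Hom.rel (k ≫ ofFun g hg)) := by
          rw [← e]
          exact comp_intro h (ofFun f hf) hx (ofFun_intro (rel_cod h hx) fun _ => rfl)
        refine comp_elim k (ofFun g hg) h1 fun M t y r' hr' hy hz => ?_
        refine ofFun_elim hz fun N v r'' e' hv => ?_
        -- At this stage the values of `h` and `k` agree in `Z` as functions, so `hsurj` supplies
        -- actual points of `P` over them.
        choose a ha using fun n => hsurj _ _ (e' n).symm
        rw [reindex_reindex, reindex_reindex]
        refine le_ex_fst _ a ?_
        simp only [reindex_inf, reindex_reindex, fun n => (ha n).1, fun n => (ha n).2]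
        exact le_inf (by simpa using le_reindex_trans hv (le_reindex_trans hr' hx))
          (le_reindex_trans hv hy)
      functional := by
        simp only [reindex_inf, reindex_reindex]
        refine functional_elim h (x := fun w : W.set × P.set × P.set => w.1)
          (y := fun w => p w.2.1) (y' := fun w => p w.2.2) (inf_le_left.trans inf_le_left)
          (inf_le_right.trans inf_le_left) fun L s r e₁ hs => ?_
        refine functional_elim k (x := fun l => (s l).1)
          (y := fun l => q (s l).2.1) (y' := fun l => q (s l).2.2)
          (le_reindex_trans hs (inf_le_left.trans inf_le_right))
          (le_reindex_trans hs (inf_le_right.trans inf_le_right)) fun M t r' e₂ ht => ?_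
        simp only [reindex_reindex]
        simp only [← fun m => hinj _ _ (e₁ (t m)) (e₂ m)]
        exact le_eqPred _ _ }
  have hl : ∀ {K : Type u} {r : Pred A K} {w : K → W.set} {a : K → P.set},
      r ≤ reindex (fun k => (w k, p (a k))) h.rel → r ≤ reindex (fun i => (w i, q (a i))) k.rel →
      r ≤ reindex (fun k => (w k, a k)) l.rel := fun h₁ h₂ => by
    simp only [l, reindex_inf, reindex_reindex]
    exact le_inf h₁ h₂
  have hlp : ∀ {K : Type u} {r : Pred A K} {w : K → W.set} {a : K → P.set},
      r ≤ reindex (fun k => (w k, a k)) l.rel →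
      r ≤ reindex (fun k => (w k, p (a k))) h.rel ∧
        r ≤ reindex (fun i => (w i, q (a i))) k.rel := fun h₁ => by
    simp only [l, reindex_inf, reindex_reindex] at h₁
    exact ⟨h₁.trans inf_le_left, h₁.trans inf_le_right⟩
  refine ⟨l, hom_eq_of_le fun K w x r hr => ?_, hom_eq_of_le fun K w y r hr => ?_,
    fun m hm hm' => hom_eq_of_le fun K w a r hr => hl ?_ ?_⟩
  · refine comp_elim l _ hr fun L s a r' hs h₁ h₂ => ?_
    refine ofFun_elim h₂ fun M t r'' e' ht => ?_
    have := le_reindex_trans ht (hlp h₁).1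
    simp only [e'] at this
    rwa [reindex_reindex, reindex_reindex]
  · refine comp_elim l _ hr fun L s a r' hs h₁ h₂ => ?_
    refine ofFun_elim h₂ fun M t r'' e' ht => ?_
    have := le_reindex_trans ht (hlp h₁).2
    simp only [e'] at this
    rwa [reindex_reindex, reindex_reindex]
  · rw [← hm]
    exact comp_intro m _ hr (ofFun_intro (rel_cod m hr) fun _ => rfl)
  · rw [← hm']
    exact comp_intro m _ hr (ofFun_intro (rel_cod m hr) fun _ => rfl)

end Reg

/-! ### The comparison functor preserves finite limits -/

namespace Groth

/-- Totality of a relation into a one-point set says that it contains the graph of the constant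
function, hence equals it. -/
theorem nonempty_isTerminal_toReg : Nonempty (IsTerminal ((toReg A).obj (terminalObj A))) := by
  refine ⟨IsTerminal.ofUniqueHom (Y := (toReg A).obj (terminalObj A))
    (fun X => Reg.ofFun (fun _ => PUnit.unit) le_top) fun X m => ?_⟩
  refine (Reg.ofFun_eq_of_le ?_).symm
  exact Reg.total_elim m (x := fun x => x) (reindex_id _).ge fun L s y q' hs h => by
    rwa [reindex_reindex]

instance preservesPullbacks_toReg : PreservesLimitsOfShape WalkingCospan (toReg A) := by
  have key : ∀ {X Y Z : Groth A} (f : X ⟶ Z) (g : Y ⟶ Z), PreservesLimit (cospan f g) (toReg A) := by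
    intro X Y Z f g
    refine preservesLimit_of_preserves_limit_cone (isLimitPullback f g)
      ((isLimitMapConePullbackConeEquiv _ _).symm (PullbackCone.isLimitAux' _ fun s => ?_))
    have H := Reg.exists_pullback_lift (X := (toReg A).obj X) (Y := (toReg A).obj Y)
      (Z := (toReg A).obj Z) (P := (toReg A).obj (pullbackObj f g))
      (hp := Groth.Hom.le (pullbackFst f g)) (hq := Groth.Hom.le (pullbackSnd f g))
      (hf := Groth.Hom.le f) (hg := Groth.Hom.le g) le_rfl
      (fun a b h h' => Subtype.ext (Prod.ext h h'))
      (fun x y h => ⟨⟨(x, y), h⟩, rfl, rfl⟩) s.fst s.snd s.condition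
    exact ⟨H.choose, H.choose_spec.1, H.choose_spec.2.1, fun {m} => H.choose_spec.2.2 m⟩
  exact ⟨fun {K} => preservesLimit_of_iso_diagram _ (diagramIsoCospan K).symm⟩

instance preservesFiniteLimits_toReg : PreservesFiniteLimits (toReg A) := by
  have : PreservesLimit (Functor.empty.{0} (Groth A)) (toReg A) :=
    preservesLimit_of_preserves_limit_cone isTerminalTerminalObj
      ((isLimitMapConeEmptyConeEquiv _ _).symm nonempty_isTerminal_toReg.some)
  have := preservesLimitsOfShape_pempty_of_preservesTerminal (toReg A)
  exact preservesFiniteLimits_of_preservesTerminal_and_pullbacks _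

end Groth

/-! ### Limits of partitioned assemblies -/

/-- An isomorphism exhibits one predicate as the reindexing of the other along the inverse function,
and U-SK is stable under reindexing. -/
instance : (isPAsm A).IsClosedUnderIsomorphisms where
  of_iso {X Y} e h := by
    have : Y.pred = reindex (Groth.Hom.fn e.inv) X.pred := by
      refine le_antisymm (Groth.Hom.le e.inv) ?_
      refine (reindex_mono _ (Groth.Hom.le e.hom)).trans ?_
      rw [reindex_reindex]
      have : (fun k => Groth.Hom.fn e.hom (Groth.Hom.fn e.inv k)) = fun k => k :=
        congrArg Groth.Hom.fn e.inv_hom_id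
      rw [this, reindex_id]
    change Y.pred.IsUSK
    rw [this]
    exact h.reindex _

theorem isPAsm_isClosedUnderLimitsOfShape_pempty (h : ∀ K : Type u, (⊤ : Pred A K).IsUSK) :
    (isPAsm A).IsClosedUnderLimitsOfShape (Discrete PEmpty.{1}) where
  limitsOfShape_le := by
    rintro X ⟨p⟩
    have hX : IsTerminal X := (isLimitEquivIsTerminalOfIsEmpty _ _ p.isLimit)
    exact (isPAsm A).prop_of_iso (Groth.isTerminalTerminalObj.uniqueUpToIso hX) (h _)

/-- Up to isomorphism the limit is the explicit pullback, whose predicate is a meet of two reindexed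
U-SK predicates. -/
theorem isPAsm_isClosedUnderLimitsOfShape_walkingCospan
    (h : ∀ (I : Type u) (p q : Pred A I), p.IsUSK → q.IsUSK → (p ⊓ q).IsUSK) :
    (isPAsm A).IsClosedUnderLimitsOfShape WalkingCospan where
  limitsOfShape_le := by
    rintro X ⟨p⟩
    have hX := IsPullback.of_isLimit_cone p.isLimit
    have hP := IsPullback.of_isLimit (Groth.isLimitPullback (p.diag.map WalkingCospan.Hom.inl)
      (p.diag.map WalkingCospan.Hom.inr))
    exact (isPAsm A).prop_of_iso (hP.isoIsPullback _ _ hX)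
      (h _ _ _ ((p.prop_diag_obj .left).reindex _) ((p.prop_diag_obj .right).reindex _))

end FiniteLimits

/-! ## Partitioned assemblies in the regular completion -/

section Main

open ImplicativeAlgebra.Pred

variable {A : Type u} [ImplicativeAlgebra A]

instance PAsm.full_toReg : (PAsm.toReg A).Full where
  map_surjective {X Y} φ := by
    obtain ⟨f, hf, h⟩ := Reg.exists_eq_ofFun (X := (PAsm.toReg A).obj X) X.property.isSK φ
    exact ⟨ObjectProperty.homMk ⟨f, hf⟩, h.symm⟩

instance PAsm.faithful_toReg : (PAsm.toReg A).Faithful where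
  map_injective {X Y} f g h := by
    apply ObjectProperty.hom_ext
    exact Groth.Hom.ext (Reg.ofFun_injective (X := (PAsm.toReg A).obj X)
      (Y := (PAsm.toReg A).obj Y) (hf := Groth.Hom.le f.hom)
      (hf' := Groth.Hom.le g.hom) X.property.isSK h)

theorem PAsm.isLexFullSubcategory (h1 : ∀ K : Type u, (⊤ : Pred A K).IsUSK)
    (h2 : ∀ (I : Type u) (p q : Pred A I), p.IsUSK → q.IsUSK → (p ⊓ q).IsUSK) :
    PAsm.IsLexFullSubcategory A := by
  have := isPAsm_isClosedUnderLimitsOfShape_pempty h1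
  have := isPAsm_isClosedUnderLimitsOfShape_walkingCospan h2
  have : HasTerminal (PAsm A) := hasLimitsOfShape_of_closedUnderLimits _ _
  have : HasPullbacks (PAsm A) := hasLimitsOfShape_of_closedUnderLimits _ _
  have h : PreservesFiniteLimits (PAsm.toGroth A) :=
    preservesFiniteLimits_of_preservesTerminal_and_pullbacks _
  exact ⟨inferInstance, inferInstance, hasFiniteLimits_of_hasTerminal_and_pullbacks, h,
    comp_preservesFiniteLimits _ _⟩

/-- Projectivity is automatic, so only the covering clause has content. A regular epimorphism from a
partitioned assembly is the graph of some `f`; being a morphism gives `∃_f q ≤ p`, and internal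
surjectivity gives the converse. -/
theorem PAsm.isProjectiveCover_iff :
    IsProjectiveCover (PAsm.toReg A) ↔
      ∀ (J : Type u) (p : Pred A J), ∃ (I : Type u) (f : I → J) (q : Pred A I),
        q.IsUSK ∧ p = ex f q := by
  constructor
  · intro h J p
    obtain ⟨X, φ, hφ⟩ := h.cover ⟨J, p⟩
    have h1 := Reg.pred_le_ex_of_isRegularEpi φ
    obtain ⟨f, hf, rfl⟩ := Reg.exists_eq_ofFun (X := (PAsm.toReg A).obj X) X.property.isSK φ
    refine ⟨X.obj.set, f, X.obj.pred, X.property, le_antisymm (h1.trans ?_) (ex_le_iff.2 hf)⟩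
    -- The existential along the second projection of the graph of `f` collapses to `∃_f`.
    refine ex_le_iff.2 (ex_le_iff.2 ?_)
    rw [reindex_reindex]
    exact ex_le_iff.1 le_rfl
  · refine fun h => ⟨fun X => Reg.isRegularProjective X.property.isSK, fun Y => ?_⟩
    obtain ⟨I, f, q, hq, e⟩ := h Y.set Y.pred
    exact ⟨⟨⟨I, q⟩, hq⟩, _, Reg.isRegularEpi_ofFun (X := ⟨I, q⟩) (f := f)
      (ex_le_iff.1 e.ge) e.le⟩

/-- The terminal partitioned assembly stays terminal among all `(K, α)`. The map to it from `(K, ⊤)`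
exhibits `⊤` as a reindexing of its U-SK predicate. -/
theorem isUSK_top_of_preservesTerminal [HasTerminal (PAsm A)]
    [PreservesLimit (Functor.empty.{0} (PAsm A)) (PAsm.toGroth A)] (K : Type u) :
    (⊤ : Pred A K).IsUSK := by
  have hT := IsTerminal.isTerminalObj (PAsm.toGroth A) _ (terminalIsTerminal (C := PAsm A))
  have h := Groth.Hom.le (hT.from (⟨K, ⊤⟩ : Groth A))
  rw [← top_le_iff.1 h]
  exact (⊤_ (PAsm A)).property.reindex _

theorem isUSK_inf_of_preservesBinaryProducts [HasBinaryProducts (PAsm A)]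
    [PreservesLimitsOfShape (Discrete WalkingPair) (PAsm.toGroth A)] {I : Type u} {p q : Pred A I}
    (hp : p.IsUSK) (hq : q.IsUSK) : (p ⊓ q).IsUSK := by
  let X : PAsm A := ⟨⟨I, p⟩, hp⟩
  let Y : PAsm A := ⟨⟨I, q⟩, hq⟩
  have hP := mapIsLimitOfPreservesOfIsLimit (PAsm.toGroth A) _ _ (prodIsProd X Y)
  let a : (⟨I, p ⊓ q⟩ : Groth A) ⟶ (PAsm.toGroth A).obj X :=
    ⟨fun i => i, inf_le_left.trans (reindex_id _).ge⟩
  let b : (⟨I, p ⊓ q⟩ : Groth A) ⟶ (PAsm.toGroth A).obj Y :=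
    ⟨fun i => i, inf_le_right.trans (reindex_id _).ge⟩
  obtain ⟨l, hl, hl'⟩ := BinaryFan.IsLimit.lift' hP a b
  -- One inequality is that the pairing `l` of the two identity functions is a morphism; the other
  -- holds because both projections composed with `l` are the identity function.
  have key : p ⊓ q = reindex (Groth.Hom.fn l) (X ⨯ Y).obj.pred := by
    refine le_antisymm (Groth.Hom.le l) (le_inf ?_ ?_)
    · have := reindex_mono (Groth.Hom.fn l) (Groth.Hom.le ((PAsm.toGroth A).map prod.fst))
      rw [reindex_reindex] at this
      have e := congrArg Groth.Hom.fn hl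
      exact this.trans ((congrArg (fun f => reindex f p) e).trans (reindex_id p)).le
    · have := reindex_mono (Groth.Hom.fn l) (Groth.Hom.le ((PAsm.toGroth A).map prod.snd))
      rw [reindex_reindex] at this
      have e := congrArg Groth.Hom.fn hl'
      exact this.trans ((congrArg (fun f => reindex f q) e).trans (reindex_id q)).le
  rw [key]
  exact (X ⨯ Y).property.reindex _

end Main

end ImplicativeAlgebra

theorem mainTheorem1 (A : Type u) [ImplicativeAlgebra A] :
    ImplicativeAlgebra.UniformlySupercoherent A ↔
      ImplicativeAlgebra.PAsm.IsLexFullSubcategory A ∧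
        IsProjectiveCover (ImplicativeAlgebra.PAsm.toReg A) := by
  open ImplicativeAlgebra in
  rw [uniformlySupercoherent_iff, PAsm.isProjectiveCover_iff, ← and_assoc]
  -- The covering condition is now the same conjunct on both sides, so only closure under `⊤` and
  -- meets has to be matched with lexness.
  refine and_congr_left' ⟨fun h => PAsm.isLexFullSubcategory h.1 h.2, fun h => ?_⟩
  have := h.hasFiniteLimits
  have := h.preserves_groth
  exact ⟨isUSK_top_of_preservesTerminal, fun I p q => isUSK_inf_of_preservesBinaryProducts⟩
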